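/- Let $n\ge 1$, let $K\subseteq\mathbb R^2$ be convex with $0$ in its interior (for example a square centred at $0$, a disc, or the whole plane), and let $I\subseteq\mathbb R$ be an interval with non-empty interior. Let $X$ be the product with $I$ of the cone of cone angle $2\pi n$, built as follows: take $n$ copies of $K\times I\subset\mathbb R^3$ (unit cubes, when $K$ is a unit square and $I$ a unit interval), cut each along the half plane $\{y=0,\ x\ge 0\}$, and identify, cyclically, the upper side of the cut of each copy with the lower side of the cut of the next copy; give $X$ the induced length metric. Let $\mathrm{dev}:X\to\mathbb R^3$ be the map that is the inclusion on each copy, and let the axis be the set of points of $X$ over $\{x=y=0\}$. Let $\nu\in\mathbb R^3\setminus\{0\}$ be any direction and put on every copy the foliation by the planes orthogonal to $\nu$. These match across the identifications and give a (singular) foliation of $X$ by hyperplanes, whose leaves are the connected components of the level sets $\{x\in X:\langle\nu,\mathrm{dev}(x)\rangle=c\}$, $c\in\mathbb R$. If such a level set contains the axis, it consists of $2n$ half planes (cut off by $K\times I$) meeting along the axis, and each union of two different ones of these half planes is also called a leaf. Then every leaf $L$ is globally area minimizing: for every rectifiable simple closed curve $\gamma$ in $L$ there is a surface $S$ contained in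 $L$ with boundary $\gamma$ whose area is at most that of every surface $S'$ in $X$ with boundary $\gamma$. Here a surface is a compact oriented Lipschitz surface of any topological type, i.e. a finite integral combination of Lipschitz maps of the unit square into $X$; it has boundary $\gamma$ if $\int_S df\wedge dg=\int_\gamma f\,dg$ for all Lipschitz functions $f,g$ on $X$; and its area is its mass, the supremum of $\int_S\omega$ over the continuous 2-forms $\omega$ of comass at most $1$ (area counted with multiplicity). -/

import Mathlib

open scoped NNReal ENNReal

namespace FlatCone

/-- Euclidean three-space; the coordinates `0, 1` are horizontal, the coordinate `2` is vertical. -/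
abbrev E3 : Type := EuclideanSpace ℝ (Fin 3)

/-! ### The space: `n` copies of `K × I`, cut along a vertical half plane and glued in a cycle -/

/-- A point of one of the `n` cut copies of `K × I ⊆ ℝ² × ℝ`. Each copy is slit along the vertical
half plane `y = 0, x ≥ 0`; the slit copy is recorded as its upper half (`y ≥ 0`) and its lower half
(`y ≤ 0`), so that every point of the slit half plane occurs twice, once on each side of the cut. -/
structure CutPoint (n : ℕ) (K : Set (EuclideanSpace ℝ (Fin 2))) (I : Set ℝ) where
  copy : Fin n
  upper : Bool
  pos : E3
  horizontal_mem : !₂[pos 0, pos 1] ∈ K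
  vertical_mem : pos 2 ∈ I
  side : if upper = true then 0 ≤ pos 1 else pos 1 ≤ 0

variable {n : ℕ} {K : Set (EuclideanSpace ℝ (Fin 2))} {I : Set ℝ}

/-- The two halves of one copy are attached along `y = 0, x ≤ 0`, which is not cut. -/
def GluedInCopy (a b : CutPoint n K I) : Prop :=
  a.pos = b.pos ∧ a.copy = b.copy ∧ a.pos 1 = 0 ∧ a.pos 0 ≤ 0

/-- The upper side of the slit of a copy is attached to the lower side of the slit of the next copy,
cyclically. -/
def GluedToNext [NeZero n] (a b : CutPoint n K I) : Prop :=
  a.pos = b.pos ∧ a.upper = true ∧ b.upper = false ∧ b.copy = a.copy + 1 ∧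
    a.pos 1 = 0 ∧ 0 ≤ a.pos 0

/-- `BrokenPath a b ℓ`: a broken line of length `ℓ` leads from `a` to `b`. It consists of straight
segments inside the (convex) halves of the copies and of passages between attached points, which
have no length. -/
inductive BrokenPath [NeZero n] : CutPoint n K I → CutPoint n K I → ℝ≥0∞ → Prop
  | segment (a b : CutPoint n K I) (hc : a.copy = b.copy) (hu : a.upper = b.upper) :
      BrokenPath a b (edist a.pos b.pos)
  | inCopy (a b : CutPoint n K I) (h : GluedInCopy a b) : BrokenPath a b 0
  | toNext (a b : CutPoint n K I) (h : GluedToNext a b) : BrokenPath a b 0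
  | symm {a b : CutPoint n K I} {l : ℝ≥0∞} (h : BrokenPath a b l) : BrokenPath b a l
  | trans {a b c : CutPoint n K I} {l m : ℝ≥0∞} (h : BrokenPath a b l) (h' : BrokenPath b c m) :
      BrokenPath a c (l + m)

/-- The length pseudometric on the disjoint union of the cut copies; attached points have
distance `0`. -/
noncomputable instance [NeZero n] : PseudoEMetricSpace (CutPoint n K I) where
  edist a b := sInf {l : ℝ≥0∞ | BrokenPath a b l}
  edist_self a := le_antisymm
    (sInf_le (by simpa using BrokenPath.segment a a rfl rfl)) zero_le
  edist_comm a b := by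
    have h : {l : ℝ≥0∞ | BrokenPath a b l} = {l : ℝ≥0∞ | BrokenPath b a l} :=
      Set.ext fun l => ⟨BrokenPath.symm, BrokenPath.symm⟩
    exact congrArg sInf h
  edist_triangle a b c := by
    rw [ENNReal.sInf_add]
    refine le_iInf₂ fun l hl => ?_
    rw [add_comm, ENNReal.sInf_add]
    refine le_iInf₂ fun m hm => ?_
    rw [add_comm]
    exact sInf_le (BrokenPath.trans hl hm)

theorem BrokenPath.edist_pos_le [NeZero n] {a b : CutPoint n K I} {l : ℝ≥0∞}
    (h : BrokenPath a b l) : edist a.pos b.pos ≤ l := by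
  induction h with
  | segment a b hc hu => exact le_rfl
  | inCopy a b h => simp [h.1]
  | toNext a b h => simp [h.1]
  | symm h ih => rwa [edist_comm]
  | trans h h' ih ih' => exact (edist_triangle _ _ _).trans (add_le_add ih ih')

theorem CutPoint.edist_pos_le [NeZero n] (a b : CutPoint n K I) :
    edist a.pos b.pos ≤ edist a b :=
  le_sInf fun _ hl => BrokenPath.edist_pos_le hl

variable (n K I) in
/-- The product of a cone of cone angle `2πn` with the interval `I`: the `n` cut copies of `K × I`
with attached points identified (the points at distance `0` are exactly the attached ones),
carrying the induced length metric. -/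
abbrev ConeProduct [NeZero n] : Type := SeparationQuotient (CutPoint n K I)

/-- The map to `ℝ³` which on each copy is the inclusion. It is a local isometry off the axis. -/
noncomputable def dev [NeZero n] : ConeProduct n K I → E3 :=
  SeparationQuotient.lift CutPoint.pos fun a b hab =>
    edist_le_zero.1 ((CutPoint.edist_pos_le a b).trans
      (EMetric.inseparable_iff.1 hab).le)

/-! ### The foliation by hyperplanes orthogonal to `ν` -/

/-- The singular set: the product of the apex of the cone with the interval. -/
def axis [NeZero n] : Set (ConeProduct n K I) := {x | dev x 0 = 0 ∧ dev x 1 = 0}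

/-- The union of the copies of the plane `⟨ν, p⟩ = c`. -/
def level [NeZero n] (ν : E3) (c : ℝ) : Set (ConeProduct n K I) := {x | inner ℝ ν (dev x) = c}

/-- The leaves of the foliation with normal direction `ν`, obtained by putting the foliation by the
planes orthogonal to `ν` on each copy: the planes of the copies join across the gluing, and the
leaves are the connected components of their unions. A plane that contains the axis gives `2n` half
planes which meet along the axis, where leaves may intersect; besides the connected set formed by
all of them, each surface formed by two of them is also counted as a leaf. -/
inductive IsLeaf [NeZero n] (ν : E3) : Set (ConeProduct n K I) → Prop
  | component (x : ConeProduct n K I) :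
      IsLeaf ν (connectedComponentIn (level ν (inner ℝ ν (dev x))) x)
  | halfPlanes (c : ℝ) (hc : axis ⊆ (level ν c : Set (ConeProduct n K I)))
      (x y : ConeProduct n K I) (hx : x ∈ level ν c \ axis) (hy : y ∈ level ν c \ axis)
      (hxy : connectedComponentIn (level ν c \ axis) x ≠
        connectedComponentIn (level ν c \ axis) y) :
      IsLeaf ν (axis ∪ connectedComponentIn (level ν c \ axis) x ∪
        connectedComponentIn (level ν c \ axis) y)

/-! ### Curves, surfaces, area -/

/-- `γ`, restricted to `[0, 1]`, is a rectifiable (Lipschitz parametrized) simple closed curve. -/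
def IsSimpleClosedCurve [NeZero n] (γ : ℝ → ConeProduct n K I) : Prop :=
  (∃ C : ℝ≥0, LipschitzOnWith C γ (Set.Icc 0 1)) ∧ γ 0 = γ 1 ∧ Set.InjOn γ (Set.Ico 0 1)

/-- The parameter square. -/
def square : Set (ℝ × ℝ) := Set.Icc 0 1 ×ˢ Set.Icc 0 1

variable (n K I) in
/-- A compact oriented Lipschitz surface, of any topological type: finitely many Lipschitz
patches with integer multiplicities (a Lipschitz 2-chain). -/
structure Surface [NeZero n] where
  size : ℕ
  mult : Fin size → ℤ
  patch : Fin size → ℝ × ℝ → ConeProduct n K I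
  lipschitz : ∀ i, ∃ C : ℝ≥0, LipschitzOnWith C (patch i) square

/-- The set of points of the surface. -/
def Surface.carrier [NeZero n] (S : Surface n K I) : Set (ConeProduct n K I) :=
  ⋃ i, S.patch i '' square

/-- `∂S = γ` in the sense of Stokes: `∫_S df ∧ dg = ∫_γ f dg` for all Lipschitz functions `f, g`. -/
def Surface.HasBoundary [NeZero n] (S : Surface n K I) (γ : ℝ → ConeProduct n K I) : Prop :=
  ∀ f g : ConeProduct n K I → ℝ, (∃ C : ℝ≥0, LipschitzWith C f) → (∃ C : ℝ≥0, LipschitzWith C g) →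
    ∑ i, (S.mult i : ℝ) * ∫ q in square,
        (fderiv ℝ (f ∘ S.patch i) q (1, 0) * fderiv ℝ (g ∘ S.patch i) q (0, 1) -
          fderiv ℝ (f ∘ S.patch i) q (0, 1) * fderiv ℝ (g ∘ S.patch i) q (1, 0)) =
      ∫ t in (0 : ℝ)..1, f (γ t) * deriv (g ∘ γ) t

/-- The triple product `⟨u, v × w⟩`. -/
noncomputable def tripleProduct (u v w : E3) : ℝ :=
  Matrix.det !![u 0, u 1, u 2; v 0, v 1, v 2; w 0, w 1, w 2]

/-- The flux of the vector field `V` through `S`, that is, the integral over `S` of the 2-form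
`V ⌟ (dx ∧ dy ∧ dz)`. -/
noncomputable def Surface.flux [NeZero n] (S : Surface n K I) (V : ConeProduct n K I → E3) : ℝ :=
  ∑ i, (S.mult i : ℝ) * ∫ q in square,
    tripleProduct (V (S.patch i q)) (fderiv ℝ (dev ∘ S.patch i) q (1, 0))
      (fderiv ℝ (dev ∘ S.patch i) q (0, 1))

/-- The area of a surface, counted with multiplicity: its mass, the supremum of the integrals over
`S` of the continuous 2-forms of comass at most `1`. -/
noncomputable def Surface.area [NeZero n] (S : Surface n K I) : ℝ≥0∞ :=
  ⨆ (V : ConeProduct n K I → E3) (_ : Continuous V) (_ : ∀ x, ‖V x‖ ≤ 1), ENNReal.ofReal (S.flux V)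

/-- `L` is globally area minimizing: for every simple closed curve in `L`, among the surfaces in the
whole space that have the curve as boundary, one of minimal area is contained in `L`. -/
def IsAreaMinimizing [NeZero n] (L : Set (ConeProduct n K I)) : Prop :=
  ∀ γ : ℝ → ConeProduct n K I, IsSimpleClosedCurve γ → (∀ t ∈ Set.Icc (0 : ℝ) 1, γ t ∈ L) →
    ∃ S : Surface n K I, S.carrier ⊆ L ∧ S.HasBoundary γ ∧
      ∀ S' : Surface n K I, S'.HasBoundary γ → S.area ≤ S'.area

end FlatCone

/-!
Choose a unit vector `e` orthogonal to `ν` and to the axis. The wall `⟨e, ·⟩ = 0` cuts the cone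
product into `2n` sheets, on each of which `dev` is injective and distances are Euclidean. Complete
`u = ν / ‖ν‖` and `e` to an orthonormal frame `u, e, σ`, and give each sheet a coefficient `κ` with
`|κ| ≤ 1`, a function of `⟨σ, ·⟩` and `⟨e, ·⟩` which vanishes on the wall. The flux form of the
field `κ u` is then `df ∧ d⟨σ, ·⟩`, where `f` is the primitive of `κ` in the direction `e` with
value `0` on the wall. These primitives join across the wall to a Lipschitz function, so by Stokes'
formula the flux of `κ u` through a surface depends only on the boundary.

A surface `S` in a leaf has normal `± u` almost everywhere, so its area is the supremum of its
fluxes for fields `h u` with `|h| ≤ 1`. On a level set of `⟨ν, ·⟩` a point is determined by its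
sheet and the coordinates `⟨σ, ·⟩, ⟨e, ·⟩`; hence every `h` is approximated by coefficients `κ` as
above, and the area of `S` is at most that of every surface with the same boundary.

A closed curve in a leaf bounds a surface in the leaf since leaves are contractible along straight
lines: towards a point of the axis if the plane of the leaf meets the axis within `K × I`, and
inside a single sheet otherwise.
-/

open MeasureTheory Filter Topology

namespace FlatCone

/-! ### Stokes' theorem for Lipschitz functions on the square -/

section LipschitzLine

variable {f g : ℝ → ℝ} {C D : ℝ≥0}

theorem intervalIntegrable_deriv_of_lipschitz (hf : LipschitzWith C f) (a b : ℝ) :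
    IntervalIntegrable (deriv f) volume a b :=
  hf.lipschitzOnWith.absolutelyContinuousOnInterval.intervalIntegrable_deriv

theorem intervalIntegrable_mul_deriv_of_lipschitz (hf : Continuous f) (hg : LipschitzWith D g)
    (a b : ℝ) : IntervalIntegrable (fun t => f t * deriv g t) volume a b :=
  (intervalIntegrable_deriv_of_lipschitz hg a b).continuousOn_mul hf.continuousOn

theorem integral_mul_deriv_sub_integral_mul_deriv {f₀ f₁ g₀ g₁ : ℝ → ℝ} {C₀ C₁ D₀ D₁ : ℝ≥0}
    (hf₀ : LipschitzWith C₀ f₀) (hf₁ : LipschitzWith C₁ f₁) (hg₀ : LipschitzWith D₀ g₀)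
    (hg₁ : LipschitzWith D₁ g₁) (a b : ℝ) :
    (∫ t in a..b, f₁ t * deriv g₁ t) - ∫ t in a..b, f₀ t * deriv g₀ t =
      (∫ t in a..b, (f₁ t - f₀ t) * deriv g₁ t) +
        (f₀ b * (g₁ b - g₀ b) - f₀ a * (g₁ a - g₀ a)) -
        ∫ t in a..b, deriv f₀ t * (g₁ t - g₀ t) := by
  have hparts₀ := hf₀.lipschitzOnWith.absolutelyContinuousOnInterval.integral_mul_deriv_eq_deriv_mul
    (a := a) (b := b) hg₀.lipschitzOnWith.absolutelyContinuousOnInterval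
  have hparts₁ := hf₀.lipschitzOnWith.absolutelyContinuousOnInterval.integral_mul_deriv_eq_deriv_mul
    (a := a) (b := b) hg₁.lipschitzOnWith.absolutelyContinuousOnInterval
  have hderiv (g : ℝ → ℝ) (hg : Continuous g) :
      IntervalIntegrable (fun t => deriv f₀ t * g t) volume a b :=
    (intervalIntegrable_deriv_of_lipschitz hf₀ a b).mul_continuousOn hg.continuousOn
  simp only [sub_mul, mul_sub]
  rw [intervalIntegral.integral_sub (hderiv _ hg₁.continuous) (hderiv _ hg₀.continuous),
    intervalIntegral.integral_sub
      (intervalIntegrable_mul_deriv_of_lipschitz hf₁.continuous hg₁ a b)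
      (intervalIntegrable_mul_deriv_of_lipschitz hf₀.continuous hg₁ a b)]
  linarith

theorem tendsto_integral_differenceQuotient {φ : ℝ → ℝ} (hφ : Continuous φ) (a b : ℝ) :
    Tendsto (fun h : ℝ => h⁻¹ * ∫ x in a..b, (φ (x + h) - φ x)) (𝓝[>] 0) (𝓝 (φ b - φ a)) := by
  have hint (c d : ℝ) : IntervalIntegrable φ volume c d := hφ.intervalIntegrable c d
  have hderiv (c : ℝ) : HasDerivAt (fun u => ∫ x in a..u, φ x) (φ c) c :=
    intervalIntegral.integral_hasDerivAt_right (hint a c)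
      (hφ.stronglyMeasurableAtFilter volume (𝓝 c)) hφ.continuousAt
  refine ((hderiv b).tendsto_slope_zero_right.sub (hderiv a).tendsto_slope_zero_right).congr
    fun h => ?_
  have hshift : ∫ x in a..b, φ (x + h) = (∫ x in a..b + h, φ x) - ∫ x in a..a + h, φ x := by
    rw [intervalIntegral.integral_comp_add_right,
      intervalIntegral.integral_interval_sub_left (hint _ _) (hint _ _)]
  have hint' : IntervalIntegrable (fun x => φ (x + h)) volume a b :=
    Continuous.intervalIntegrable (by fun_prop) a b
  rw [intervalIntegral.integral_sub hint' (hint a b), hshift, intervalIntegral.integral_same,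
    smul_eq_mul, smul_eq_mul]
  ring

end LipschitzLine

section TranslatedSlope

variable {E : Type*} [NormedAddCommGroup E] [NormedSpace ℝ E]

theorem continuousAt_indicator_one {X : Type*} [TopologicalSpace X] {s : Set X} {x : X}
    (hx : x ∉ frontier s) : ContinuousAt (s.indicator (1 : X → ℝ)) x := by
  have hx' : x ∈ interior s ∪ interior sᶜ := by
    rwa [← Set.mem_compl_iff, compl_frontier_eq_union_interior] at hx
  rcases hx' with hx' | hx' <;> rw [mem_interior_iff_mem_nhds] at hx'
  · exact (continuousAt_const (y := (1 : ℝ))).congr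
      (mem_of_superset hx' fun y hy => (Set.indicator_of_mem hy 1).symm)
  · exact (continuousAt_const (y := (0 : ℝ))).congr
      (mem_of_superset hx' fun y hy => (Set.indicator_of_notMem hy 1).symm)

theorem norm_slope_le_of_lipschitz {f : E → ℝ} {C : ℝ≥0} (hf : LipschitzWith C f) {t : ℝ}
    (ht : 0 < t) (x v : E) : ‖t⁻¹ * (f x - f (x - t • v))‖ ≤ C * ‖v‖ := by
  rw [norm_mul, norm_inv, Real.norm_of_nonneg ht.le, inv_mul_le_iff₀ ht]
  simpa [norm_smul, abs_of_pos ht, mul_left_comm] using hf.norm_sub_le x (x - t • v)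

theorem tendsto_slope_of_lineDifferentiableAt {f : E → ℝ} {x v : E}
    (hf : LineDifferentiableAt ℝ f x (-v)) :
    Tendsto (fun t : ℝ => t⁻¹ * (f x - f (x - t • v))) (𝓝[>] 0) (𝓝 (lineDeriv ℝ f x v)) := by
  have h := hf.hasLineDerivAt.tendsto_slope_zero_right.neg
  rw [lineDeriv_neg, neg_neg] at h
  refine h.congr fun t => ?_
  rw [smul_neg, ← sub_eq_add_neg, smul_eq_mul]
  ring

theorem norm_indicator_translate_le (s : Set E) {t : ℝ} (ht : t ∈ Set.Icc 0 1) (x v : E) :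
    ‖s.indicator (1 : E → ℝ) (x - t • v)‖ ≤ (Metric.cthickening ‖v‖ s).indicator 1 x := by
  by_cases hx : x - t • v ∈ s
  · have hx' : x ∈ Metric.cthickening ‖v‖ s := by
      refine Metric.mem_cthickening_of_dist_le x _ _ _ hx ?_
      simpa [dist_eq_norm, norm_smul, abs_of_nonneg ht.1] using
        mul_le_of_le_one_left (norm_nonneg v) ht.2
    simp [hx, hx']
  · rw [Set.indicator_of_notMem hx, norm_zero]
    exact Set.indicator_nonneg (fun _ _ => zero_le_one) x

theorem setIntegral_comp_add_right {G : Type*} [AddGroup G] [MeasurableSpace G] [MeasurableAdd G]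
    {μ : Measure G} [μ.IsAddRightInvariant] {s : Set G} (hs : MeasurableSet s) (g : G → ℝ) (w : G) :
    ∫ x in s, g (x + w) ∂μ = ∫ x, s.indicator 1 (x - w) * g x ∂μ := by
  rw [← integral_indicator hs, ← integral_sub_right_eq_self _ w]
  refine integral_congr_ae (.of_forall fun x => ?_)
  by_cases hx : x - w ∈ s <;> simp [hx]

variable [MeasurableSpace E] [BorelSpace E] [FiniteDimensional ℝ E] {μ : Measure E}
  [μ.IsAddHaarMeasure] {f g : E → ℝ} {C : ℝ≥0} {s : Set E}

theorem tendsto_setIntegral_slope_mul (hf : LipschitzWith C f) (hg : IntegrableOn g s μ)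
    (hs : MeasurableSet s) (v : E) :
    Tendsto (fun t : ℝ => ∫ x in s, t⁻¹ * (f (x + t • v) - f x) * g x ∂μ) (𝓝[>] 0)
      (𝓝 (∫ x in s, lineDeriv ℝ f x v * g x ∂μ)) := by
  have h := hf.integral_inv_smul_sub_mul_tendsto_integral_lineDeriv_mul
    (hg.integrable_indicator hs) v
  refine (h.congr fun t => ?_).trans_eq ?_ <;> rw [← integral_indicator hs]
  all_goals simp only [Set.indicator_mul_right, smul_eq_mul]

theorem tendsto_setIntegral_slope_mul_translate {M : ℝ} (hf : LipschitzWith C f)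
    (hg : Measurable g) (hgM : ∀ x, ‖g x‖ ≤ M) (hs : IsCompact s) (hs0 : μ (frontier s) = 0)
    (v : E) :
    Tendsto (fun t : ℝ => ∫ x in s, t⁻¹ * (f (x + t • v) - f x) * g (x + t • v) ∂μ) (𝓝[>] 0)
      (𝓝 (∫ x in s, lineDeriv ℝ f x v * g x ∂μ)) := by
  let slope (t : ℝ) (x : E) : ℝ := t⁻¹ * (f x - f (x - t • v)) * g x
  have hmoved (t : ℝ) : ∫ x in s, t⁻¹ * (f (x + t • v) - f x) * g (x + t • v) ∂μ =
      ∫ x, s.indicator 1 (x - t • v) * slope t x ∂μ := by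
    simp only [← setIntegral_comp_add_right hs.measurableSet, slope, add_sub_cancel_right]
  have hfixed : ∫ x in s, lineDeriv ℝ f x v * g x ∂μ =
      ∫ x, s.indicator 1 (x - (0 : E)) * (lineDeriv ℝ f x v * g x) ∂μ := by
    simp only [← setIntegral_comp_add_right hs.measurableSet, add_zero]
  have hslope (t : ℝ) (ht : 0 < t) (x : E) : ‖slope t x‖ ≤ C * ‖v‖ * M :=
    (norm_mul_le _ _).trans (mul_le_mul (norm_slope_le_of_lipschitz hf ht x v) (hgM x)
      (norm_nonneg _) (by positivity))
  simp only [hmoved, hfixed, sub_zero]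
  refine tendsto_integral_filter_of_dominated_convergence
    (fun x => (Metric.cthickening ‖v‖ s).indicator 1 x * (C * ‖v‖ * M)) ?_ ?_ ?_ ?_
  · have hf' := hf.continuous.measurable
    have hind : Measurable (s.indicator (1 : E → ℝ)) := measurable_one.indicator hs.measurableSet
    exact .of_forall fun t => Measurable.aestronglyMeasurable (by fun_prop)
  · filter_upwards [Ioc_mem_nhdsGT (zero_lt_one' ℝ)] with t ht
    refine .of_forall fun x => (norm_mul_le _ _).trans ?_
    exact mul_le_mul (norm_indicator_translate_le s ⟨ht.1.le, ht.2⟩ x v) (hslope t ht.1 x)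
      (norm_nonneg _) (Set.indicator_nonneg (fun _ _ => zero_le_one) x)
  · exact ((integrable_indicator_iff hs.cthickening.measurableSet).2
      (integrableOn_const hs.cthickening.measure_ne_top)).mul_const _
  · filter_upwards [measure_eq_zero_iff_ae_notMem.1 hs0, hf.ae_lineDifferentiableAt (-v)]
      with x hxs hx
    have hmove : Tendsto (fun t : ℝ => x - t • v) (𝓝[>] 0) (𝓝 x) := by
      have : Continuous fun t : ℝ => x - t • v := by fun_prop
      simpa using (this.tendsto 0).mono_left nhdsWithin_le_nhds
    exact ((continuousAt_indicator_one hxs).tendsto.comp hmove).mul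
      ((tendsto_slope_of_lineDifferentiableAt hx).mul_const _)

end TranslatedSlope

section Square

theorem isCompact_square : IsCompact square := isCompact_Icc.prod isCompact_Icc

theorem convex_square : Convex ℝ square := (convex_Icc 0 1).prod (convex_Icc 0 1)

theorem integrableOn_square {f : ℝ × ℝ → ℝ} {M : ℝ} (hf : AEStronglyMeasurable f)
    (hM : ∀ q, ‖f q‖ ≤ M) : IntegrableOn f square :=
  Measure.integrableOn_of_bounded isCompact_square.measure_ne_top hf (.of_forall hM)

theorem setIntegral_square {f : ℝ × ℝ → ℝ} (hf : IntegrableOn f square) :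
    ∫ q in square, f q = ∫ x in (0 : ℝ)..1, ∫ y in (0 : ℝ)..1, f (x, y) := by
  simp only [intervalIntegral.integral_of_le zero_le_one, ← integral_Icc_eq_integral_Ioc]
  exact setIntegral_prod f hf

variable {F G : ℝ × ℝ → ℝ} {C D : ℝ≥0}

theorem lineDeriv_vertical (G : ℝ × ℝ → ℝ) (x y : ℝ) :
    lineDeriv ℝ G (x, y) (0, 1) = deriv (fun y => G (x, y)) y := by
  simpa [lineDeriv] using deriv_comp_const_add (fun y => G (x, y)) y 0

theorem lineDeriv_horizontal (G : ℝ × ℝ → ℝ) (x y : ℝ) :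
    lineDeriv ℝ G (x, y) (1, 0) = deriv (fun x => G (x, y)) x := by
  simpa [lineDeriv] using deriv_comp_const_add (fun x => G (x, y)) x 0

theorem lipschitzWith_column (hF : LipschitzWith C F) (x : ℝ) :
    LipschitzWith C fun y => F (x, y) :=
  mul_one C ▸ hF.comp (LipschitzWith.prodMk_left x)

theorem lipschitzWith_row (hF : LipschitzWith C F) (y : ℝ) : LipschitzWith C fun x => F (x, y) :=
  mul_one C ▸ hF.comp (LipschitzWith.prodMk_right y)

theorem norm_lineDeriv_vertical_le (hF : LipschitzWith C F) (q : ℝ × ℝ) :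
    ‖lineDeriv ℝ F q (0, 1)‖ ≤ C := by
  simpa using norm_lineDeriv_le_of_lipschitz ℝ hF (x₀ := q) (v := (0, 1))

/-- The integral of the form `F dG` along the vertical segment `{x} × [0, 1]`. -/
noncomputable def columnIntegral (F G : ℝ × ℝ → ℝ) (x : ℝ) : ℝ :=
  ∫ y in (0 : ℝ)..1, F (x, y) * lineDeriv ℝ G (x, y) (0, 1)

theorem columnIntegral_sub (hF : LipschitzWith C F) (hG : LipschitzWith D G) (x x' : ℝ) :
    columnIntegral F G x' - columnIntegral F G x =
      (∫ y in (0 : ℝ)..1, (F (x', y) - F (x, y)) * lineDeriv ℝ G (x', y) (0, 1)) +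
        (F (x, 1) * (G (x', 1) - G (x, 1)) - F (x, 0) * (G (x', 0) - G (x, 0))) -
        ∫ y in (0 : ℝ)..1, lineDeriv ℝ F (x, y) (0, 1) * (G (x', y) - G (x, y)) := by
  simp only [columnIntegral, lineDeriv_vertical]
  exact integral_mul_deriv_sub_integral_mul_deriv (lipschitzWith_column hF x)
    (lipschitzWith_column hF x') (lipschitzWith_column hG x) (lipschitzWith_column hG x') 0 1

theorem norm_sub_row_le (hF : LipschitzWith C F) (x x' y : ℝ) :
    ‖F (x', y) - F (x, y)‖ ≤ C * |x' - x| :=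
  (lipschitzWith_row hF y).norm_sub_le x' x

theorem continuous_columnIntegral (hF : LipschitzWith C F) (hG : LipschitzWith D G) :
    Continuous (columnIntegral F G) := by
  refine continuous_iff_continuousAt.2 fun x => ?_
  have hbound (x' : ℝ) : ‖columnIntegral F G x' - columnIntegral F G x‖ ≤
      (C * D + (|F (x, 1)| + |F (x, 0)|) * D + C * D) * |x' - x| := by
    have h1 : ‖∫ y in (0 : ℝ)..1, (F (x', y) - F (x, y)) * lineDeriv ℝ G (x', y) (0, 1)‖ ≤
        C * |x' - x| * D * |1 - 0| :=
      intervalIntegral.norm_integral_le_of_norm_le_const fun y _ => norm_mul_le_of_le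
        (norm_sub_row_le hF x x' y) (norm_lineDeriv_vertical_le hG _)
    have h2 : ‖∫ y in (0 : ℝ)..1, lineDeriv ℝ F (x, y) (0, 1) * (G (x', y) - G (x, y))‖ ≤
        C * (D * |x' - x|) * |1 - 0| :=
      intervalIntegral.norm_integral_le_of_norm_le_const fun y _ => norm_mul_le_of_le
        (norm_lineDeriv_vertical_le hF _) (norm_sub_row_le hG x x' y)
    have h3 (y : ℝ) : ‖F (x, y) * (G (x', y) - G (x, y))‖ ≤ |F (x, y)| * (D * |x' - x|) :=
      norm_mul_le_of_le le_rfl (norm_sub_row_le hG x x' y)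
    rw [columnIntegral_sub hF hG]
    refine (norm_sub_le_of_le (norm_add_le_of_le h1
      (norm_sub_le_of_le (h3 1) (h3 0))) h2).trans_eq ?_
    norm_num
    ring
  refine tendsto_iff_norm_sub_tendsto_zero.2 (squeeze_zero (fun _ => norm_nonneg _) hbound ?_)
  have hcont : Continuous fun x' : ℝ =>
      (C * D + (|F (x, 1)| + |F (x, 0)|) * D + C * D : ℝ) * |x' - x| := by fun_prop
  simpa using hcont.tendsto x

/-- The integral of the form `F dG` along the horizontal segment `[0, 1] × {y}`. -/
noncomputable def rowIntegral (F G : ℝ × ℝ → ℝ) (y : ℝ) : ℝ :=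
  ∫ x in (0 : ℝ)..1, F (x, y) * lineDeriv ℝ G (x, y) (1, 0)

theorem tendsto_row_slope (hF : Continuous F) (hG : LipschitzWith D G) (y : ℝ) :
    Tendsto (fun h : ℝ => h⁻¹ * ∫ x in (0 : ℝ)..1, F (x, y) * (G (x + h, y) - G (x, y)))
      (𝓝[>] 0) (𝓝 (rowIntegral F G y)) := by
  have hFint : IntegrableOn (fun x => F (x, y)) (Set.Ioc 0 1) :=
    ((by fun_prop : Continuous fun x => F (x, y)).integrableOn_Icc).mono_set Set.Ioc_subset_Icc_self
  have h := tendsto_setIntegral_slope_mul (lipschitzWith_row hG y) hFint measurableSet_Ioc 1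
  simp only [rowIntegral, intervalIntegral.integral_of_le zero_le_one, ← integral_const_mul]
  refine (h.congr fun t => ?_).trans_eq ?_
  · simp only [smul_eq_mul, mul_one]
    congr 1 with x
    ring
  · simp [lineDeriv, mul_comm]

theorem intervalIntegrable_integral_of_square {f : ℝ × ℝ → ℝ} (hf : IntegrableOn f square) :
    IntervalIntegrable (fun x => ∫ y in (0 : ℝ)..1, f (x, y)) volume 0 1 := by
  rw [intervalIntegrable_iff_integrableOn_Icc_of_le zero_le_one]
  simp only [intervalIntegral.integral_of_le zero_le_one, ← integral_Icc_eq_integral_Ioc]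
  rw [IntegrableOn, square, Measure.volume_eq_prod, ← Measure.prod_restrict] at hf
  exact hf.integral_prod_left

theorem integral_columnIntegral_sub (hF : LipschitzWith C F) (hG : LipschitzWith D G) (h : ℝ) :
    ∫ x in (0 : ℝ)..1, (columnIntegral F G (x + h) - columnIntegral F G x) =
      (∫ q in square, (F (q + h • (1, 0)) - F q) * lineDeriv ℝ G (q + h • (1, 0)) (0, 1)) +
        ((∫ x in (0 : ℝ)..1, F (x, 1) * (G (x + h, 1) - G (x, 1))) -
          ∫ x in (0 : ℝ)..1, F (x, 0) * (G (x + h, 0) - G (x, 0))) -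
        ∫ q in square, (G (q + h • (1, 0)) - G q) * lineDeriv ℝ F q (0, 1) := by
  have hF' := hF.continuous
  have hG' := hG.continuous
  have hdiff {H : ℝ × ℝ → ℝ} {B : ℝ≥0} (hH : LipschitzWith B H) (q : ℝ × ℝ) :
      ‖H (q + h • (1, 0)) - H q‖ ≤ B * ‖h‖ := by
    refine (hH.norm_sub_le _ _).trans_eq ?_
    rw [add_sub_cancel_left, norm_smul, Prod.norm_mk, norm_one, norm_zero, max_eq_left zero_le_one,
      mul_one]
  have hint₁ : IntegrableOn (fun q : ℝ × ℝ =>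
      (F (q + h • (1, 0)) - F q) * lineDeriv ℝ G (q + h • (1, 0)) (0, 1)) square := by
    have := measurable_lineDeriv (𝕜 := ℝ) (v := (0, 1)) hG'
    exact integrableOn_square (Measurable.aestronglyMeasurable (by fun_prop))
      fun q => norm_mul_le_of_le (hdiff hF q) (norm_lineDeriv_vertical_le hG _)
  have hint₂ : IntegrableOn (fun q : ℝ × ℝ =>
      (G (q + h • (1, 0)) - G q) * lineDeriv ℝ F q (0, 1)) square := by
    have := measurable_lineDeriv (𝕜 := ℝ) (v := (0, 1)) hF'
    exact integrableOn_square (Measurable.aestronglyMeasurable (by fun_prop))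
      fun q => norm_mul_le_of_le (hdiff hG q) (norm_lineDeriv_vertical_le hF _)
  have hrow (y : ℝ) : IntervalIntegrable (fun x => F (x, y) * (G (x + h, y) - G (x, y)))
      volume 0 1 := Continuous.intervalIntegrable (by fun_prop) 0 1
  have hinner₁ := intervalIntegrable_integral_of_square hint₁
  have hinner₂ := intervalIntegrable_integral_of_square hint₂
  rw [setIntegral_square hint₁, setIntegral_square hint₂,
    ← intervalIntegral.integral_sub (hrow 1) (hrow 0),
    ← intervalIntegral.integral_add hinner₁ ((hrow 1).sub (hrow 0)),
    ← intervalIntegral.integral_sub (hinner₁.add ((hrow 1).sub (hrow 0))) hinner₂]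
  simp only [columnIntegral_sub hF hG, Prod.smul_mk, smul_eq_mul, mul_one, mul_zero, Prod.mk_add_mk,
    add_zero, mul_comm (lineDeriv ℝ F _ _)]

theorem integral_square_wedge (hF : LipschitzWith C F) (hG : LipschitzWith D G) :
    ∫ q in square, (lineDeriv ℝ F q (1, 0) * lineDeriv ℝ G q (0, 1) -
        lineDeriv ℝ F q (0, 1) * lineDeriv ℝ G q (1, 0)) =
      rowIntegral F G 0 + columnIntegral F G 1 - rowIntegral F G 1 - columnIntegral F G 0 := by
  have hmeas {H : ℝ × ℝ → ℝ} {B : ℝ≥0} (hH : LipschitzWith B H) (v : ℝ × ℝ) :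
      Measurable fun q => lineDeriv ℝ H q v := measurable_lineDeriv hH.continuous
  have hbound {H : ℝ × ℝ → ℝ} {B : ℝ≥0} (hH : LipschitzWith B H) (v q : ℝ × ℝ) :
      ‖lineDeriv ℝ H q v‖ ≤ B * ‖v‖ := norm_lineDeriv_le_of_lipschitz ℝ hH
  have hint {v w : ℝ × ℝ} {H₁ H₂ : ℝ × ℝ → ℝ} {B₁ B₂ : ℝ≥0} (hH₁ : LipschitzWith B₁ H₁)
      (hH₂ : LipschitzWith B₂ H₂) :
      IntegrableOn (fun q => lineDeriv ℝ H₁ q v * lineDeriv ℝ H₂ q w) square :=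
    integrableOn_square ((hmeas hH₁ v).mul (hmeas hH₂ w)).aestronglyMeasurable
      fun q => norm_mul_le_of_le (hbound hH₁ v q) (hbound hH₂ w q)
  have hlim₁ := tendsto_setIntegral_slope_mul_translate hF (hmeas hG (0, 1)) (hbound hG (0, 1))
    isCompact_square (convex_square.addHaar_frontier volume) (1, 0)
  have hlim₂ := tendsto_setIntegral_slope_mul hG (integrableOn_square
    (hmeas hF (0, 1)).aestronglyMeasurable (hbound hF (0, 1))) isCompact_square.measurableSet (1, 0)
  have hlim := (hlim₁.add ((tendsto_row_slope hF.continuous hG 1).sub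
    (tendsto_row_slope hF.continuous hG 0))).sub hlim₂
  have heq := tendsto_nhds_unique (tendsto_integral_differenceQuotient
    (continuous_columnIntegral hF hG) 0 1) (hlim.congr fun h => by
      rw [integral_columnIntegral_sub hF hG]
      simp only [mul_assoc, integral_const_mul]
      ring)
  simp only [mul_comm (lineDeriv ℝ F _ (0, 1))]
  rw [integral_sub (hint hF hG) (hint hG hF)]
  linarith

end Square

section NullHomotopy

theorem ae_square_mem_nhds : ∀ᵐ q ∂volume.restrict square, square ∈ 𝓝 q := by
  rw [ae_restrict_iff' isCompact_square.measurableSet]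
  filter_upwards [measure_eq_zero_iff_ae_notMem.1 (convex_square.addHaar_frontier volume)]
    with q hfrontier hq
  by_contra h
  exact hfrontier ⟨subset_closure hq, fun h' => h (mem_interior_iff_mem_nhds.1 h')⟩

theorem ae_fderiv_eq_lineDeriv {f F : ℝ × ℝ → ℝ} {C : ℝ≥0} (hF : LipschitzWith C F)
    (hfF : Set.EqOn f F square) :
    ∀ᵐ q ∂volume.restrict square, ∀ v, fderiv ℝ f q v = lineDeriv ℝ F q v := by
  filter_upwards [ae_square_mem_nhds, ae_restrict_of_ae hF.ae_differentiableAt] with q hq hd v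
  rw [hd.lineDeriv_eq_fderiv, (hfF.eventuallyEq_of_mem hq).fderiv_eq]

theorem integral_mul_deriv_congr {f F g G : ℝ → ℝ} {a b : ℝ} (hab : a ≤ b)
    (hf : Set.EqOn f F (Set.Icc a b)) (hg : Set.EqOn g G (Set.Icc a b)) :
    ∫ t in a..b, f t * deriv g t = ∫ t in a..b, F t * deriv G t :=
  intervalIntegral.integral_congr_Ioo_of_le hab fun t ht => by
    simp only [hf (Set.Ioo_subset_Icc_self ht),
      (hg.eventuallyEq_of_mem (Icc_mem_nhds ht.1 ht.2)).deriv_eq]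

variable {n : ℕ} [NeZero n] {K : Set (EuclideanSpace ℝ (Fin 2))} {I : Set ℝ}

/-- The surface consisting of a single patch. -/
def Surface.single (Φ : ℝ × ℝ → ConeProduct n K I) (h : ∃ C : ℝ≥0, LipschitzOnWith C Φ square) :
    Surface n K I where
  size := 1
  mult _ := 1
  patch _ := Φ
  lipschitz _ := h

theorem Surface.carrier_single (Φ : ℝ × ℝ → ConeProduct n K I)
    (h : ∃ C : ℝ≥0, LipschitzOnWith C Φ square) : (single Φ h).carrier = Φ '' square :=
  Set.iUnion_const (ι := Fin 1) (Φ '' square)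

theorem Surface.hasBoundary_single {Φ : ℝ × ℝ → ConeProduct n K I}
    (h : ∃ C : ℝ≥0, LipschitzOnWith C Φ square) {γ : ℝ → ConeProduct n K I} {p : ConeProduct n K I}
    (hbottom : ∀ t ∈ Set.Icc (0 : ℝ) 1, Φ (t, 0) = γ t)
    (htop : ∀ t ∈ Set.Icc (0 : ℝ) 1, Φ (t, 1) = p)
    (hsides : ∀ r ∈ Set.Icc (0 : ℝ) 1, Φ (0, r) = Φ (1, r)) : (single Φ h).HasBoundary γ := by
  rintro f g ⟨Cf, hf⟩ ⟨Cg, hg⟩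
  obtain ⟨C, hΦ⟩ := h
  obtain ⟨F, hF, hfF⟩ := (hf.comp_lipschitzOnWith hΦ).extend_real
  obtain ⟨G, hG, hgG⟩ := (hg.comp_lipschitzOnWith hΦ).extend_real
  have h0 : (0 : ℝ) ∈ Set.Icc (0 : ℝ) 1 := Set.left_mem_Icc.2 zero_le_one
  have h1 : (1 : ℝ) ∈ Set.Icc (0 : ℝ) 1 := Set.right_mem_Icc.2 zero_le_one
  have hsurface : ∫ q in square, (fderiv ℝ (f ∘ Φ) q (1, 0) * fderiv ℝ (g ∘ Φ) q (0, 1) -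
        fderiv ℝ (f ∘ Φ) q (0, 1) * fderiv ℝ (g ∘ Φ) q (1, 0)) =
      rowIntegral F G 0 + columnIntegral F G 1 - rowIntegral F G 1 - columnIntegral F G 0 := by
    rw [← integral_square_wedge hF hG]
    refine integral_congr_ae ?_
    filter_upwards [ae_fderiv_eq_lineDeriv hF hfF, ae_fderiv_eq_lineDeriv hG hgG] with q hfq hgq
    simp only [hfq, hgq]
  have hrow₀ : rowIntegral F G 0 = ∫ t in (0 : ℝ)..1, f (γ t) * deriv (g ∘ γ) t := by
    simp only [rowIntegral, lineDeriv_horizontal]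
    exact integral_mul_deriv_congr zero_le_one
      (fun t ht => (hfF ⟨ht, h0⟩).symm.trans (congrArg f (hbottom t ht)))
      (fun t ht => (hgG ⟨ht, h0⟩).symm.trans (congrArg g (hbottom t ht)))
  have hrow₁ : rowIntegral F G 1 = 0 := by
    simp only [rowIntegral, lineDeriv_horizontal]
    rw [integral_mul_deriv_congr zero_le_one (fun _ _ => rfl)
      (fun t ht => (hgG ⟨ht, h1⟩).symm.trans (congrArg g (htop t ht)))]
    simp only [deriv_const, mul_zero, intervalIntegral.integral_zero]
  have hcolumn : columnIntegral F G 1 = columnIntegral F G 0 := by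
    simp only [columnIntegral, lineDeriv_vertical]
    exact integral_mul_deriv_congr zero_le_one
      (fun r hr => ((hfF ⟨h1, hr⟩).symm.trans (congrArg f (hsides r hr).symm)).trans (hfF ⟨h0, hr⟩))
      (fun r hr => ((hgG ⟨h1, hr⟩).symm.trans (congrArg g (hsides r hr).symm)).trans (hgG ⟨h0, hr⟩))
  refine (Fin.sum_univ_one _).trans ?_
  simp only [single, Int.cast_one, one_mul]
  rw [hsurface, hrow₀, hrow₁, hcolumn]
  ring

end NullHomotopy

section Sheets

/-! ### Walls and sheets of the cone product -/

variable {n : ℕ} {K : Set (EuclideanSpace ℝ (Fin 2))} {I : Set ℝ}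

variable (K I) in
/-- The convex body `K × I` of which the copies are cut. -/
def solid : Set E3 := {p | !₂[p 0, p 1] ∈ K ∧ p 2 ∈ I}

theorem convex_solid (hK : Convex ℝ K) (hI : I.OrdConnected) : Convex ℝ (solid K I) := by
  intro p hp q hq a b ha hb hab
  refine ⟨?_, by simpa using hI.convex hp.2 hq.2 ha hb hab⟩
  convert hK hp.1 hq.1 ha hb hab using 1
  ext i
  fin_cases i <;> simp

theorem CutPoint.pos_mem_solid (a : CutPoint n K I) : a.pos ∈ solid K I :=
  ⟨a.horizontal_mem, a.vertical_mem⟩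

theorem inner_eq_sum (u v : E3) : inner ℝ u v = u 0 * v 0 + u 1 * v 1 + u 2 * v 2 := by
  simp only [PiLp.inner_apply, Fin.sum_univ_three, RCLike.inner_apply, conj_trivial]
  ring

/-- Normal vectors of walls: the wall `⟨e, p⟩ = 0` of a wall normal `e` contains the axis, and the
slit of each copy lies in the closed half space `⟨e, p⟩ ≥ 0`. -/
structure IsWallNormal (e : E3) : Prop where
  zero_nonneg : 0 ≤ e 0
  two_eq_zero : e 2 = 0

namespace IsWallNormal

variable {e p : E3}

theorem inner_eq (he : IsWallNormal e) (hp : p 1 = 0) : inner ℝ e p = e 0 * p 0 := by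
  simp [inner_eq_sum, he.two_eq_zero, hp]

theorem inner_nonneg (he : IsWallNormal e) (hp : p 1 = 0) (h : 0 ≤ p 0) : 0 ≤ inner ℝ e p :=
  he.inner_eq hp ▸ mul_nonneg he.zero_nonneg h

theorem inner_nonpos (he : IsWallNormal e) (hp : p 1 = 0) (h : p 0 ≤ 0) : inner ℝ e p ≤ 0 :=
  he.inner_eq hp ▸ mul_nonpos_of_nonneg_of_nonpos he.zero_nonneg h

end IsWallNormal

section Separated

variable {E : Type*} [NormedAddCommGroup E] [InnerProductSpace ℝ E] {e p q : E}

theorem abs_inner_add_abs_inner_of_separated (h : ¬(0 < inner ℝ e p ↔ 0 < inner ℝ e q)) :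
    |inner ℝ e p| + |inner ℝ e q| = |inner ℝ e (p - q)| := by
  rw [inner_sub_right]
  rcases lt_or_ge 0 (inner ℝ e p) with hp | hp <;> rcases lt_or_ge 0 (inner ℝ e q) with hq | hq
  · exact absurd (iff_of_true hp hq) h
  · rw [abs_of_pos hp, abs_of_nonpos hq, abs_of_pos (by linarith), sub_eq_add_neg]
  · rw [abs_of_nonpos hp, abs_of_pos hq, abs_of_neg (by linarith)]
    ring
  · exact absurd (iff_of_false hp.not_gt hq.not_gt) h

theorem edist_le_of_separated {C D : ℝ≥0} {g h : E → ℝ} (hg : ∀ p, |g p| ≤ D * |inner ℝ e p|)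
    (hh : ∀ p, |h p| ≤ D * |inner ℝ e p|) (hC : D * ‖e‖₊ ≤ C)
    (hpq : ¬(0 < inner ℝ e p ↔ 0 < inner ℝ e q)) : edist (g p) (h q) ≤ C * edist p q := by
  have hC' : (D : ℝ) * ‖e‖ ≤ C := by exact_mod_cast hC
  rw [edist_dist, edist_dist, ← ENNReal.ofReal_coe_nnreal, ← ENNReal.ofReal_mul C.coe_nonneg]
  refine ENNReal.ofReal_le_ofReal ?_
  rw [Real.dist_eq, dist_eq_norm]
  calc |g p - h q|
      ≤ |g p| + |h q| := abs_sub _ _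
    _ ≤ D * |inner ℝ e p| + D * |inner ℝ e q| := add_le_add (hg _) (hh _)
    _ = D * |inner ℝ e (p - q)| := by rw [← mul_add, abs_inner_add_abs_inner_of_separated hpq]
    _ ≤ D * (‖e‖ * ‖p - q‖) := by
      gcongr
      exact abs_real_inner_le_norm _ _
    _ ≤ C * ‖p - q‖ := by
      rw [← mul_assoc]
      gcongr

end Separated

theorem edist_add_edist_of_mem_segment {E : Type*} [SeminormedAddCommGroup E] [NormedSpace ℝ E]
    {a b c : E} (hc : c ∈ segment ℝ a b) : edist a c + edist c b = edist a b := by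
  simp only [edist_dist, ← ENNReal.ofReal_add dist_nonneg dist_nonneg,
    dist_add_dist_of_mem_segment hc]

theorem exists_mem_segment_apply_eq_zero {E : Type*} [AddCommGroup E] [Module ℝ E]
    [TopologicalSpace E] [IsTopologicalAddGroup E] [ContinuousSMul ℝ E] {f : E → ℝ}
    (hf : Continuous f) {a b : E} (ha : 0 ≤ f a) (hb : f b ≤ 0) :
    ∃ c ∈ segment ℝ a b, f c = 0 :=
  (convex_segment a b).isPreconnected.intermediate_value (right_mem_segment ℝ a b)
    (left_mem_segment ℝ a b) hf.continuousOn ⟨hb, ha⟩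

variable [NeZero n] {e : E3}

/-- The sheet containing a point, among the `2n` components of `⟨e, ·⟩ ≠ 0` for a wall normal `e`.
The sheet on which `⟨e, ·⟩ > 0` crosses the slit; it is numbered by the copy of its upper half. -/
noncomputable def CutPoint.sheet (e : E3) (a : CutPoint n K I) : Fin n × Bool :=
  (if a.upper = false ∧ 0 < inner ℝ e a.pos then a.copy - 1 else a.copy,
    decide (0 < inner ℝ e a.pos))

namespace CutPoint

variable {a b : CutPoint n K I}

theorem sheet_eq_of_pos_iff (hc : a.copy = b.copy) (hu : a.upper = b.upper)
    (h : 0 < inner ℝ e a.pos ↔ 0 < inner ℝ e b.pos) : a.sheet e = b.sheet e := by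
  simp only [sheet, hc, hu, h]

theorem inner_pos_iff_of_sheet_eq (hs : a.sheet e = b.sheet e) :
    0 < inner ℝ e a.pos ↔ 0 < inner ℝ e b.pos := by
  simpa [sheet] using congrArg Prod.snd hs

theorem copy_eq_of_sheet_eq (hs : a.sheet e = b.sheet e) (hu : a.upper = b.upper) :
    a.copy = b.copy := by
  have h := congrArg Prod.fst hs
  simp only [sheet, inner_pos_iff_of_sheet_eq hs, hu] at h
  split_ifs at h
  · exact sub_left_injective h
  · exact h

theorem le_mul_edist {d : ℝ≥0∞} {C : ℝ≥0} (hC : C ≠ 0)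
    (h : ∀ l, BrokenPath a b l → d ≤ C * l) : d ≤ C * edist a b := by
  have hC' : (C : ℝ≥0∞) ≠ 0 := by exact_mod_cast hC
  rw [mul_comm, ← ENNReal.div_le_iff hC' ENNReal.coe_ne_top]
  refine le_sInf fun l hl => ?_
  rw [ENNReal.div_le_iff hC' ENNReal.coe_ne_top, mul_comm]
  exact h l hl

end CutPoint

theorem GluedInCopy.sheet_eq (he : IsWallNormal e) {a b : CutPoint n K I} (h : GluedInCopy a b) :
    a.sheet e = b.sheet e := by
  obtain ⟨hp, hc, h1, h0⟩ := h
  have hb : ¬0 < inner ℝ e b.pos := (hp ▸ he.inner_nonpos h1 h0).not_gt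
  simp [CutPoint.sheet, hp, hc, hb]

theorem GluedToNext.sheet_eq (he : IsWallNormal e) {a b : CutPoint n K I} (h : GluedToNext a b)
    (hb : inner ℝ e b.pos ≠ 0) : a.sheet e = b.sheet e := by
  obtain ⟨hp, hau, hbu, hc, h1, h0⟩ := h
  have hb' : 0 < inner ℝ e b.pos := (hp ▸ he.inner_nonneg h1 h0).lt_of_ne' hb
  simp [CutPoint.sheet, hp, hc, hau, hbu, hb']

theorem BrokenPath.edist_glue_le (he : IsWallNormal e) {C D : ℝ≥0} {G : Fin n × Bool → E3 → ℝ}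
    (hG : ∀ j, LipschitzWith C (G j)) (hD : ∀ j p, |G j p| ≤ D * |inner ℝ e p|)
    (hC : D * ‖e‖₊ ≤ C) {a b : CutPoint n K I} {l : ℝ≥0∞} (h : BrokenPath a b l) :
    edist (G (a.sheet e) a.pos) (G (b.sheet e) b.pos) ≤ C * l := by
  induction h with
  | segment a b hc hu =>
    by_cases hab : 0 < inner ℝ e a.pos ↔ 0 < inner ℝ e b.pos
    · rw [CutPoint.sheet_eq_of_pos_iff hc hu hab]
      exact hG _ _ _
    · exact edist_le_of_separated (hD _) (hD _) hC hab
  | inCopy a b h => simp [h.sheet_eq he, h.1]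
  | toNext a b h =>
    by_cases hb : inner ℝ e b.pos = 0
    · have hzero : ∀ j, G j b.pos = 0 := fun j => by simpa [hb] using hD j b.pos
      simp [h.1, hzero]
    · simp [h.sheet_eq he hb, h.1]
  | symm h ih => rwa [edist_comm]
  | trans h h' ih ih' =>
    rw [mul_add]
    exact (edist_triangle _ _ _).trans (add_le_add ih ih')

namespace CutPoint

variable {a b : CutPoint n K I}

theorem edist_glue_le (he : IsWallNormal e) {C D : ℝ≥0} {G : Fin n × Bool → E3 → ℝ}
    (hG : ∀ j, LipschitzWith C (G j)) (hD : ∀ j p, |G j p| ≤ D * |inner ℝ e p|)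
    (hC : D * ‖e‖₊ ≤ C) (hC0 : C ≠ 0) (a b : CutPoint n K I) :
    edist (G (a.sheet e) a.pos) (G (b.sheet e) b.pos) ≤ C * edist a b :=
  le_mul_edist hC0 fun _ hl => hl.edist_glue_le he hG hD hC

theorem sheet_eq_of_nnnorm_mul_edist_lt (he : IsWallNormal e)
    (h : ‖e‖₊ * edist a b < ‖inner ℝ e a.pos‖ₑ) : a.sheet e = b.sheet e := by
  classical
  by_contra hne
  have he0 : ‖e‖₊ ≠ 0 := fun he0 => by simp [nnnorm_eq_zero.1 he0] at h
  have hG : ∀ j, LipschitzWith ‖e‖₊ fun p : E3 => if j = a.sheet e then inner ℝ e p else (0 : ℝ) :=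
    fun j => by
      split_ifs
      · exact LipschitzWith.of_dist_le_mul fun p q => by
          rw [Real.dist_eq, dist_eq_norm, ← inner_sub_right]
          exact abs_real_inner_le_norm _ _
      · exact (LipschitzWith.const (0 : ℝ)).weaken zero_le
  have hle := edist_glue_le he hG (D := 1) (fun j p => by split_ifs <;> simp) (by simp) he0 a b
  rw [if_pos rfl, if_neg (Ne.symm hne), edist_zero_right] at hle
  exact (h.trans_le hle).false

theorem glued_of_sheet_eq (he : IsWallNormal e) (ha : a.upper = true) (hb : b.upper = false)
    (hpos : a.pos = b.pos) (h1 : a.pos 1 = 0) (hs : a.sheet e = b.sheet e)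
    (hne : inner ℝ e a.pos ≠ 0) : BrokenPath a b 0 := by
  have hfst := congrArg Prod.fst hs
  rcases lt_or_gt_of_ne hne with hlt | hgt
  · have h0 : a.pos 0 ≤ 0 := le_of_not_ge fun h => (he.inner_nonneg h1 h).not_gt hlt
    refine .inCopy a b ⟨hpos, ?_, h1, h0⟩
    simpa [sheet, ← hpos, hlt.not_gt] using hfst
  · have h0 : 0 ≤ a.pos 0 := le_of_not_ge fun h => (he.inner_nonpos h1 h).not_gt hgt
    refine .toNext a b ⟨hpos, ha, hb, ?_, h1, h0⟩
    simp only [sheet, ha, hb, ← hpos, hgt, and_true, if_true, Bool.true_eq_false, if_false] at hfst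
    rw [hfst, sub_add_cancel]

theorem edist_le_of_upper_of_lower (hS : Convex ℝ (solid K I)) (he : IsWallNormal e)
    (hau : a.upper = true) (hbu : b.upper = false) (hs : a.sheet e = b.sheet e)
    (ha : inner ℝ e a.pos ≠ 0) (hb : inner ℝ e b.pos ≠ 0) : edist a b ≤ edist a.pos b.pos := by
  have hay : 0 ≤ a.pos 1 := by simpa [hau] using a.side
  have hby : b.pos 1 ≤ 0 := by simpa [hbu] using b.side
  obtain ⟨c, hc, hc1⟩ := exists_mem_segment_apply_eq_zero (f := fun p : E3 => p 1)
    (by fun_prop) hay hby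
  have hcS : c ∈ solid K I := hS.segment_subset a.pos_mem_solid b.pos_mem_solid hc
  have hiff := inner_pos_iff_of_sheet_eq hs
  have hce : inner ℝ e c ≠ 0 ∧ (0 < inner ℝ e c ↔ 0 < inner ℝ e b.pos) := by
    have hlin : IsLinearMap ℝ fun p : E3 => inner ℝ e p := (innerₗ E3 e).isLinear
    rcases lt_or_gt_of_ne hb with hlt | hgt
    · have ha' : inner ℝ e a.pos < 0 := (not_lt.1 fun h => hlt.not_gt (hiff.1 h)).lt_of_ne ha
      have hc' : inner ℝ e c < 0 := (convex_halfSpace_lt hlin 0).segment_subset ha' hlt hc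
      exact ⟨hc'.ne, iff_of_false hc'.not_gt hlt.not_gt⟩
    · have hc' : 0 < inner ℝ e c := (convex_halfSpace_gt hlin 0).segment_subset (hiff.2 hgt) hgt hc
      exact ⟨hc'.ne', iff_of_true hc' hgt⟩
  let cu : CutPoint n K I := ⟨a.copy, true, c, hcS.1, hcS.2, by simp [hc1]⟩
  let cl : CutPoint n K I := ⟨b.copy, false, c, hcS.1, hcS.2, by simp [hc1]⟩
  have hcs : cu.sheet e = cl.sheet e := by
    rw [sheet_eq_of_pos_iff (a := cu) (b := a) rfl hau.symm (hce.2.trans hiff.symm), hs,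
      sheet_eq_of_pos_iff (a := cl) (b := b) rfl hbu.symm hce.2]
  have hpath := ((BrokenPath.segment a cu rfl hau).trans
    (glued_of_sheet_eq (b := cl) he rfl rfl rfl hc1 hcs hce.1)).trans (.segment cl b rfl hbu.symm)
  rw [add_zero, edist_add_edist_of_mem_segment hc] at hpath
  exact sInf_le hpath

theorem edist_le_of_sheet_eq (hS : Convex ℝ (solid K I)) (he : IsWallNormal e)
    (hs : a.sheet e = b.sheet e) (ha : inner ℝ e a.pos ≠ 0) (hb : inner ℝ e b.pos ≠ 0) :
    edist a b ≤ edist a.pos b.pos := by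
  by_cases hab : a.upper = b.upper
  · exact sInf_le (.segment a b (copy_eq_of_sheet_eq hs hab) hab)
  cases hau : a.upper
  · rw [edist_comm a, edist_comm a.pos]
    exact edist_le_of_upper_of_lower hS he (by simpa [hau] using hab) hau hs.symm hb ha
  · exact edist_le_of_upper_of_lower hS he hau (by simpa [hau] using hab) hs ha hb

end CutPoint

/-- The sheet of a point of the cone product; on the walls the value depends on a choice of
representative. -/
noncomputable def sheet (e : E3) (x : ConeProduct n K I) : Fin n × Bool :=
  (Quotient.out x : CutPoint n K I).sheet e

theorem dev_mk (a : CutPoint n K I) : dev (SeparationQuotient.mk a) = a.pos := rfl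

theorem mk_out (x : ConeProduct n K I) :
    SeparationQuotient.mk (Quotient.out x : CutPoint n K I) = x := Quotient.out_eq x

theorem pos_out (x : ConeProduct n K I) : (Quotient.out x : CutPoint n K I).pos = dev x := by
  rw [← dev_mk, mk_out]

theorem edist_out (x y : ConeProduct n K I) :
    edist (Quotient.out x : CutPoint n K I) (Quotient.out y) = edist x y := by
  rw [← SeparationQuotient.edist_mk, mk_out, mk_out]

theorem lipschitzWith_dev : LipschitzWith 1 (dev : ConeProduct n K I → E3) := by
  intro x y
  rw [← edist_out, ← pos_out, ← pos_out, ENNReal.coe_one, one_mul]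
  exact CutPoint.edist_pos_le _ _

theorem dev_mem_solid (x : ConeProduct n K I) : dev x ∈ solid K I :=
  pos_out x ▸ (Quotient.out x : CutPoint n K I).pos_mem_solid

theorem lipschitzWith_inner_dev (w : E3) :
    LipschitzWith ‖w‖₊ fun x : ConeProduct n K I => inner ℝ w (dev x) := by
  have hw : ‖innerSL ℝ w‖₊ = ‖w‖₊ := NNReal.eq (innerSL_apply_norm ℝ w)
  simpa [Function.comp_def, hw] using (innerSL ℝ w).lipschitz.comp lipschitzWith_dev

theorem lipschitzWith_glue (he : IsWallNormal e) {C D : ℝ≥0} {G : Fin n × Bool → E3 → ℝ}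
    (hG : ∀ j, LipschitzWith C (G j)) (hD : ∀ j p, |G j p| ≤ D * |inner ℝ e p|)
    (hC : D * ‖e‖₊ ≤ C) (hC0 : C ≠ 0) :
    LipschitzWith C fun x : ConeProduct n K I => G (sheet e x) (dev x) := by
  intro x y
  simp only [← edist_out x y, ← pos_out]
  exact CutPoint.edist_glue_le he hG hD hC hC0 _ _

theorem edist_le_of_sheet_eq (hS : Convex ℝ (solid K I)) (he : IsWallNormal e)
    {x y : ConeProduct n K I} (hs : sheet e x = sheet e y) (hx : inner ℝ e (dev x) ≠ 0)
    (hy : inner ℝ e (dev y) ≠ 0) : edist x y ≤ edist (dev x) (dev y) := by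
  rw [← pos_out] at hx hy
  rw [← edist_out, ← pos_out, ← pos_out]
  exact CutPoint.edist_le_of_sheet_eq hS he hs hx hy

theorem eventually_sheet_eq (he : IsWallNormal e) {x : ConeProduct n K I}
    (hx : inner ℝ e (dev x) ≠ 0) : ∀ᶠ y in 𝓝 x, sheet e y = sheet e x := by
  have hlim : Tendsto (fun y => ‖e‖₊ * edist x y) (𝓝 x) (𝓝 (‖e‖₊ * edist x x)) :=
    ENNReal.Tendsto.const_mul (tendsto_const_nhds.edist tendsto_id) (Or.inr ENNReal.coe_ne_top)
  have hlt : ‖e‖₊ * edist x x < ‖inner ℝ e (dev x)‖ₑ := by simpa using hx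
  filter_upwards [hlim.eventually_lt_const hlt] with y hy
  rw [← edist_out, ← pos_out] at hy
  exact (CutPoint.sheet_eq_of_nnnorm_mul_edist_lt he hy).symm

theorem sheet_mk (he : IsWallNormal e) {a : CutPoint n K I} (ha : inner ℝ e a.pos ≠ 0) :
    sheet e (SeparationQuotient.mk a) = a.sheet e := by
  have h0 : edist a (Quotient.out (SeparationQuotient.mk a) : CutPoint n K I) = 0 := by
    rw [← SeparationQuotient.edist_mk, mk_out, edist_self]
  exact (CutPoint.sheet_eq_of_nnnorm_mul_edist_lt he (by simpa [h0] using ha)).symm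

end Sheets

section Frames

/-! ### Frames of a plane in space -/

theorem tripleProduct_eq (u v w : E3) : tripleProduct u v w =
    u 0 * (v 1 * w 2 - v 2 * w 1) - u 1 * (v 0 * w 2 - v 2 * w 0) +
      u 2 * (v 0 * w 1 - v 1 * w 0) := by
  simp only [tripleProduct, Matrix.det_fin_three, Matrix.of_apply, Matrix.cons_val',
    Matrix.cons_val]
  ring

theorem tripleProduct_smul (c : ℝ) (u v w : E3) :
    tripleProduct (c • u) v w = c * tripleProduct u v w := by
  simp only [tripleProduct_eq, PiLp.smul_apply, smul_eq_mul]
  ring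

theorem tripleProduct_eq_inner_cross (u v w : E3) :
    tripleProduct u v w = inner ℝ u (WithLp.toLp 2 (crossProduct v.ofLp w.ofLp)) := by
  simp only [tripleProduct_eq, inner_eq_sum, cross_apply, Matrix.cons_val]
  ring

theorem abs_tripleProduct_le (u v w : E3) : |tripleProduct u v w| ≤ ‖u‖ * (‖v‖ * ‖w‖) := by
  rw [tripleProduct_eq_inner_cross]
  refine (abs_real_inner_le_norm _ _).trans ?_
  gcongr
  rw [InnerProductGeometry.norm_ofLp_crossProduct]
  exact mul_le_of_le_one_right (by positivity) (Real.sin_le_one _)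

/-- A positively oriented orthonormal basis `u, e, σ` of space whose second vector is a wall
normal, so that `e, σ` are orthonormal coordinate directions in the planes orthogonal to `u`. -/
structure IsFrame (u e σ : E3) : Prop where
  isWallNormal : IsWallNormal e
  orthonormal : Orthonormal ℝ ![u, e, σ]
  tripleProduct_eq_one : tripleProduct u e σ = 1

theorem exists_isWallNormal_orthogonal (u : E3) :
    ∃ e : E3, IsWallNormal e ∧ ‖e‖ = 1 ∧ inner ℝ u e = 0 := by
  obtain ⟨e, he, hne, hue⟩ : ∃ e : E3, IsWallNormal e ∧ e ≠ 0 ∧ inner ℝ u e = 0 := by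
    by_cases h : u 1 = 0
    · refine ⟨!₂[0, 1, 0], ⟨by simp, by simp⟩, fun h0 => ?_, by simp [inner_eq_sum, h]⟩
      simpa using congrArg (fun v : E3 => v 1) h0
    · refine ⟨!₂[1, -(u 0 / u 1), 0], ⟨by simp, by simp⟩, fun h0 => ?_, ?_⟩
      · simpa using congrArg (fun v : E3 => v 0) h0
      · simp [inner_eq_sum, mul_div_cancel₀ _ h]
  have hnonneg : 0 ≤ ‖e‖⁻¹ * e 0 := mul_nonneg (inv_nonneg.2 (norm_nonneg e)) he.zero_nonneg
  exact ⟨‖e‖⁻¹ • e, ⟨by simpa using hnonneg, by simp [he.two_eq_zero]⟩,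
    norm_smul_inv_norm hne, by rw [inner_smul_right, hue, mul_zero]⟩

theorem exists_isFrame {u : E3} (hu : ‖u‖ = 1) : ∃ e σ : E3, IsFrame u e σ := by
  obtain ⟨e, he, he1, hue⟩ := exists_isWallNormal_orthogonal u
  set σ : E3 := WithLp.toLp 2 (crossProduct u.ofLp e.ofLp) with hσ
  have hσ_inner : ∀ v, inner ℝ v σ = tripleProduct v u e := fun v =>
    (tripleProduct_eq_inner_cross v u e).symm
  have huσ : inner ℝ u σ = 0 := by rw [hσ_inner, tripleProduct_eq]; ring
  have heσ : inner ℝ e σ = 0 := by rw [hσ_inner, tripleProduct_eq]; ring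
  have hσ1 : ‖σ‖ = 1 := by
    rw [hσ, InnerProductGeometry.norm_ofLp_crossProduct, hu, he1,
      InnerProductGeometry.inner_eq_zero_iff_angle_eq_pi_div_two u e |>.1 hue, Real.sin_pi_div_two]
    norm_num
  refine ⟨e, σ, he, ⟨fun i => ?_, fun i j hij => ?_⟩, ?_⟩
  · fin_cases i <;> simp [hu, he1, hσ1]
  · fin_cases i <;> fin_cases j <;> simp [hue, huσ, heσ, real_inner_comm] at hij ⊢
  · calc tripleProduct u e σ = tripleProduct σ u e := by
          simp only [tripleProduct_eq]
          ring
      _ = 1 := by rw [← hσ_inner, real_inner_self_eq_norm_sq, hσ1, one_pow]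

namespace IsFrame

variable {u e σ : E3}

theorem norm_normal (h : IsFrame u e σ) : ‖u‖ = 1 := h.orthonormal.norm_eq_one 0

theorem norm_fst (h : IsFrame u e σ) : ‖e‖ = 1 := h.orthonormal.norm_eq_one 1

theorem norm_snd (h : IsFrame u e σ) : ‖σ‖ = 1 := h.orthonormal.norm_eq_one 2

theorem decomposition (h : IsFrame u e σ) (p : E3) :
    inner ℝ u p • u + inner ℝ e p • e + inner ℝ σ p • σ = p := by
  have hcard : Fintype.card (Fin 3) = Module.finrank ℝ E3 := by simp
  let b := (basisOfOrthonormalOfCardEqFinrank h.orthonormal hcard).toOrthonormalBasis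
    (by simpa using h.orthonormal)
  simpa [b, Fin.sum_univ_three] using b.sum_repr' p

theorem tripleProduct_of_orthogonal (h : IsFrame u e σ) {a b : E3} (ha : inner ℝ u a = 0)
    (hb : inner ℝ u b = 0) (v : E3) :
    tripleProduct v a b = inner ℝ v u * tripleProduct u a b := by
  rw [← h.decomposition a, ← h.decomposition b, ha, hb, real_inner_comm u v]
  nth_rewrite 1 [← h.decomposition v]
  simp only [tripleProduct_eq, PiLp.add_apply, PiLp.smul_apply, smul_eq_mul]
  ring

theorem tripleProduct_normal (h : IsFrame u e σ) (a b : E3) :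
    tripleProduct u a b = inner ℝ e a * inner ℝ σ b - inner ℝ e b * inner ℝ σ a := by
  have hexpand : ∀ x y z x' y' z' : ℝ,
      tripleProduct u (x • u + y • e + z • σ) (x' • u + y' • e + z' • σ) =
        (y * z' - y' * z) * tripleProduct u e σ := fun x y z x' y' z' => by
    simp only [tripleProduct_eq, PiLp.add_apply, PiLp.smul_apply, smul_eq_mul]
    ring
  nth_rewrite 1 [← h.decomposition a, ← h.decomposition b]
  rw [hexpand, h.tripleProduct_eq_one, mul_one]

theorem norm_le_of_orthogonal (h : IsFrame u e σ) {p : E3} (hp : inner ℝ u p = 0) :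
    ‖p‖ ≤ |inner ℝ e p| + |inner ℝ σ p| := by
  calc ‖p‖ = ‖inner ℝ e p • e + inner ℝ σ p • σ‖ := by
        nth_rewrite 1 [← h.decomposition p]
        rw [hp, zero_smul, zero_add]
    _ ≤ ‖inner ℝ e p • e‖ + ‖inner ℝ σ p • σ‖ := norm_add_le _ _
    _ = |inner ℝ e p| + |inner ℝ σ p| := by
        rw [norm_smul, norm_smul, h.norm_fst, h.norm_snd, mul_one, mul_one, Real.norm_eq_abs,
          Real.norm_eq_abs]

end IsFrame

end Frames

section Differentials

/-! ### Differentials of Lipschitz functions -/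

theorem ae_differentiableAt_of_lipschitzOn_square {E : Type*} [NormedAddCommGroup E]
    [NormedSpace ℝ E] [FiniteDimensional ℝ E] {F : ℝ × ℝ → E} {C : ℝ≥0}
    (hF : LipschitzOnWith C F square) : ∀ᵐ q ∂volume.restrict square, DifferentiableAt ℝ F q := by
  filter_upwards [hF.ae_differentiableWithinAt isCompact_square.measurableSet, ae_square_mem_nhds]
    with q hq hn using hq.differentiableAt hn

theorem hasFDerivAt_zero_of_abs {E : Type*} [NormedAddCommGroup E] [NormedSpace ℝ E] {Y : E → ℝ}
    {q : E} (h0 : Y q = 0) (hY : DifferentiableAt ℝ (fun p => |Y p|) q) :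
    HasFDerivAt Y (0 : E →L[ℝ] ℝ) q := by
  have hmin : IsLocalMin (fun p => |Y p|) q := .of_forall fun p => by simp [h0]
  have habs := hY.hasFDerivAt
  rw [hmin.fderiv_eq_zero, hasFDerivAt_iff_isLittleO] at habs
  rw [hasFDerivAt_iff_isLittleO]
  simpa [h0] using habs

theorem ae_hasFDerivAt_zero_of_eq_zero {Y : ℝ × ℝ → ℝ} {C : ℝ≥0}
    (hY : LipschitzOnWith C Y square) :
    ∀ᵐ q ∂volume.restrict square, Y q = 0 → HasFDerivAt Y (0 : ℝ × ℝ →L[ℝ] ℝ) q := by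
  filter_upwards [ae_differentiableAt_of_lipschitzOn_square
    ((lipschitzWith_one_norm (E := ℝ)).comp_lipschitzOnWith hY)] with q hq h0
  exact hasFDerivAt_zero_of_abs h0 hq

theorem wedge_eq_zero_of_abs_sub_le {E : Type*} [NormedAddCommGroup E]
    [NormedSpace ℝ E] {R T : E → ℝ} {A B : E →L[ℝ] ℝ} {q : E} (hR : HasFDerivAt R A q)
    (hT : HasFDerivAt T B q) {C : ℝ} (h : ∀ᶠ p in 𝓝 q, |R p - R q| ≤ C * |T p - T q|) (v w : E) :
    A v * B w - A w * B v = 0 := by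
  set x := B w • v - B v • w
  have hBx : B x = 0 := by simp only [x, map_sub, map_smul, smul_eq_mul]; ring
  have hline : Tendsto (fun t : ℝ => q + t • x) (𝓝 0) (𝓝 q) := by
    have hcont : Continuous fun t : ℝ => q + t • x := by fun_prop
    simpa using hcont.tendsto 0
  have hO : (fun t : ℝ => R (q + t • x) - R q) =O[𝓝 0] fun t : ℝ => T (q + t • x) - T q :=
    .of_bound C (hline.eventually h)
  have hT0 := hT.hasLineDerivAt x
  have hR0 : HasLineDerivAt ℝ R 0 q x := by
    rw [hBx] at hT0
    rw [HasLineDerivAt, hasDerivAt_iff_isLittleO_nhds_zero] at hT0 ⊢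
    simp only [zero_add, zero_smul, add_zero, smul_zero, sub_zero] at hT0 ⊢
    exact hO.trans_isLittleO hT0
  have hAx : A x = 0 := (hR.hasLineDerivAt x).unique hR0
  simp only [x, map_sub, map_smul, smul_eq_mul] at hAx
  linarith

end Differentials

section Envelope

/-! ### Approximation by Lipschitz coefficients -/

variable {ι P : Type*} [PseudoMetricSpace P] {z : ι → P} {h : ι → ℝ}

/-- The Pasch–Hausdorff envelope: the largest `m`-Lipschitz function `g` with `g (z i) ≤ h i`. -/
noncomputable def lipschitzEnvelope (z : ι → P) (h : ι → ℝ) (m : ℕ) (p : P) : ℝ :=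
  ⨅ i, h i + m * dist p (z i)

theorem bddBelow_envelope (hb : BddBelow (Set.range h)) (m : ℕ) (p : P) :
    BddBelow (Set.range fun i => h i + m * dist p (z i)) := by
  obtain ⟨b, hb⟩ := hb
  refine ⟨b, ?_⟩
  rintro _ ⟨i, rfl⟩
  exact (hb ⟨i, rfl⟩).trans (le_add_of_nonneg_right (by positivity))

theorem lipschitzWith_lipschitzEnvelope (hb : BddBelow (Set.range h)) (m : ℕ) :
    LipschitzWith m (lipschitzEnvelope z h m) := by
  rcases isEmpty_or_nonempty ι with hι | hι
  · have hzero : lipschitzEnvelope z h m = fun _ => 0 := funext fun p => Real.iInf_of_isEmpty _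
    exact hzero ▸ (LipschitzWith.const (0 : ℝ)).weaken zero_le
  refine LipschitzWith.of_le_add_mul _ fun p q => ?_
  rw [← sub_le_iff_le_add]
  refine le_ciInf fun i => ?_
  have hm : (m : ℝ) * dist p (z i) ≤ m * (dist p q + dist q (z i)) := by
    gcongr
    exact dist_triangle _ _ _
  have hinf : lipschitzEnvelope z h m p ≤ h i + m * dist p (z i) :=
    ciInf_le (bddBelow_envelope hb m p) i
  rw [NNReal.coe_natCast]
  linarith

theorem lipschitzEnvelope_le (hb : BddBelow (Set.range h)) (m : ℕ) (i : ι) :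
    lipschitzEnvelope z h m (z i) ≤ h i := by
  simpa [lipschitzEnvelope] using ciInf_le (bddBelow_envelope (z := z) hb m (z i)) i

theorem tendsto_lipschitzEnvelope (hb : BddBelow (Set.range h)) {i : ι}
    (hi : Tendsto h (comap z (𝓝 (z i))) (𝓝 (h i))) :
    Tendsto (fun m => lipschitzEnvelope z h m (z i)) atTop (𝓝 (h i)) := by
  have : Nonempty ι := ⟨i⟩
  obtain ⟨b, hbound⟩ := hb
  refine tendsto_order.2 ⟨fun a ha => ?_, fun a ha =>
    .of_forall fun m => (lipschitzEnvelope_le ⟨b, hbound⟩ m i).trans_lt ha⟩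
  obtain ⟨a', ha', ha''⟩ := exists_between ha
  obtain ⟨δ, hδ, hball⟩ :=
    (Metric.nhds_basis_ball.comap z).eventually_iff.1 (hi.eventually_const_lt ha'')
  have hlarge : ∀ᶠ m : ℕ in atTop, a' - b ≤ m * δ :=
    (tendsto_natCast_atTop_atTop.atTop_mul_const hδ).eventually_ge_atTop _
  filter_upwards [hlarge] with m hm
  refine ha'.trans_le (le_ciInf fun i' => ?_)
  rcases lt_or_ge (dist (z i') (z i)) δ with hd | hd
  · exact (hball hd).le.trans (le_add_of_nonneg_right (by positivity))
  · have hd' : m * δ ≤ m * dist (z i) (z i') := by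
      rw [dist_comm]
      gcongr
    linarith [hbound ⟨i', rfl⟩]

/-- A cutoff function which vanishes at `0` and near infinity. -/
noncomputable def cutoff (m : ℕ) (t : ℝ) : ℝ := max 0 (min 1 (min (m * |t|) (m + 1 - |t|)))

theorem cutoff_nonneg (m : ℕ) (t : ℝ) : 0 ≤ cutoff m t := le_max_left _ _

theorem cutoff_le_one (m : ℕ) (t : ℝ) : cutoff m t ≤ 1 := max_le zero_le_one (min_le_left _ _)

theorem cutoff_zero (m : ℕ) : cutoff m 0 = 0 := by
  simp [cutoff]

theorem cutoff_eq_zero_of_lt {m : ℕ} {t : ℝ} (ht : m + 1 < |t|) : cutoff m t = 0 :=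
  max_eq_left ((min_le_right _ _).trans ((min_le_right _ _).trans (by linarith)))

theorem lipschitzWith_cutoff (m : ℕ) : LipschitzWith (m + 1) (cutoff m) := by
  have hinner : LipschitzWith m fun t : ℝ => m * |t| := by
    simpa [Function.comp_def] using
      (lipschitzWith_smul (m : ℝ)).comp (lipschitzWith_one_norm (E := ℝ))
  have houter : LipschitzWith 1 fun t : ℝ => m + 1 - |t| := by
    simpa using (LipschitzWith.const ((m : ℝ) + 1)).sub (lipschitzWith_one_norm (E := ℝ))
  exact (((hinner.min houter).const_min 1).const_max 0).weaken (max_le (by simp) (by simp))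

theorem tendsto_cutoff {t : ℝ} (ht : t ≠ 0) : Tendsto (fun m => cutoff m t) atTop (𝓝 1) := by
  have hinner : ∀ᶠ m : ℕ in atTop, 1 ≤ m * |t| :=
    (tendsto_natCast_atTop_atTop.atTop_mul_const (abs_pos.2 ht)).eventually_ge_atTop 1
  have houter : ∀ᶠ m : ℕ in atTop, |t| ≤ m := tendsto_natCast_atTop_atTop.eventually_ge_atTop _
  refine tendsto_const_nhds.congr' ?_
  filter_upwards [hinner, houter] with m hi ho
  rw [cutoff, min_eq_left (le_min hi (by linarith)), max_eq_right zero_le_one]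

end Envelope

section Calibration

/-! ### Calibrations -/

/-- Coefficients of calibrations: functions of coordinates `(s, t)` bounded by `1`, vanishing on the
wall `t = 0`, where the sheets are joined, and for large `|t|`. -/
structure IsCoefficient (L R : ℝ≥0) (κ : ℝ × ℝ → ℝ) : Prop where
  lipschitz : LipschitzWith L κ
  abs_le_one : ∀ p, |κ p| ≤ 1
  eq_zero_of_snd_eq_zero : ∀ p : ℝ × ℝ, p.2 = 0 → κ p = 0
  eq_zero_of_lt_abs_snd : ∀ p : ℝ × ℝ, R < |p.2| → κ p = 0

/-- The primitive of `κ` in the second variable which vanishes on the wall. -/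
noncomputable def primitive (κ : ℝ × ℝ → ℝ) (p : ℝ × ℝ) : ℝ := ∫ τ in (0 : ℝ)..p.2, κ (p.1, τ)

theorem hasDerivAt_primitive {κ : ℝ × ℝ → ℝ} (hκ : Continuous κ) (s t : ℝ) :
    HasDerivAt (fun t => primitive κ (s, t)) (κ (s, t)) t :=
  have hs : Continuous fun τ => κ (s, τ) := by fun_prop
  intervalIntegral.integral_hasDerivAt_right (hs.intervalIntegrable _ _)
    (hs.stronglyMeasurableAtFilter _ _) hs.continuousAt

namespace IsCoefficient

variable {L R : ℝ≥0} {κ : ℝ × ℝ → ℝ}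

theorem abs_le_mul_abs_snd (hκ : IsCoefficient L R κ) (p : ℝ × ℝ) : |κ p| ≤ L * |p.2| := by
  have h := hκ.lipschitz.dist_le_mul p (p.1, 0)
  rwa [Real.dist_eq, hκ.eq_zero_of_snd_eq_zero (p.1, 0) rfl, sub_zero, Prod.dist_eq, dist_self,
    max_eq_right dist_nonneg, Real.dist_eq, sub_zero] at h

theorem abs_primitive_sub_le_snd (hκ : IsCoefficient L R κ) (s t t' : ℝ) :
    |primitive κ (s, t) - primitive κ (s, t')| ≤ |t - t'| := by
  have hs : Continuous fun τ => κ (s, τ) := hκ.lipschitz.continuous.comp (by fun_prop)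
  have hint := fun a b => hs.intervalIntegrable (μ := volume) a b
  have hbound := intervalIntegral.norm_integral_le_of_norm_le_const (f := fun τ => κ (s, τ))
    (a := t') (b := t) fun τ _ => hκ.abs_le_one (s, τ)
  rw [one_mul] at hbound
  simp only [primitive]
  rwa [intervalIntegral.integral_interval_sub_left (hint _ _) (hint _ _)]

theorem abs_primitive_sub_le_fst (hκ : IsCoefficient L R κ) (s s' t : ℝ) :
    |primitive κ (s, t) - primitive κ (s', t)| ≤ 2 * R * L * |s - s'| := by
  have hcont : ∀ s, Continuous fun τ => κ (s, τ) := fun s =>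
    hκ.lipschitz.continuous.comp (by fun_prop)
  have hint := fun s => (hcont s).intervalIntegrable (μ := volume) 0 t
  set f : ℝ → ℝ := fun τ => κ (s, τ) - κ (s', τ)
  set J : Set ℝ := Set.uIoc 0 t ∩ Set.Icc (-R) R
  have hJ : volume.real J ≤ 2 * R := by
    refine (measureReal_mono Set.inter_subset_right measure_Icc_lt_top.ne).trans_eq ?_
    rw [Real.volume_real_Icc_of_le (by simp)]
    ring
  have hsupport : ∫ τ in Set.uIoc 0 t, f τ = ∫ τ in J, f τ := by
    refine setIntegral_eq_of_subset_of_forall_sdiff_eq_zero measurableSet_uIoc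
      Set.inter_subset_left fun τ hτ => ?_
    have hlt : (R : ℝ) < |τ| := lt_of_not_ge fun h => hτ.2 ⟨hτ.1, abs_le.1 h⟩
    simp only [f, hκ.eq_zero_of_lt_abs_snd (_, τ) hlt, sub_self]
  have hbound : ∀ τ ∈ J, ‖f τ‖ ≤ L * |s - s'| := fun τ _ => by
    simpa [f, Real.dist_eq, Prod.dist_eq] using hκ.lipschitz.dist_le_mul (s, τ) (s', τ)
  calc |primitive κ (s, t) - primitive κ (s', t)| = ‖∫ τ in (0 : ℝ)..t, f τ‖ := by
        rw [primitive, primitive, ← intervalIntegral.integral_sub (hint s) (hint s'),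
          Real.norm_eq_abs]
    _ = ‖∫ τ in J, f τ‖ := by rw [intervalIntegral.norm_intervalIntegral_eq, hsupport]
    _ ≤ L * |s - s'| * volume.real J := norm_setIntegral_le_of_norm_le_const
        ((measure_mono Set.inter_subset_right).trans_lt measure_Icc_lt_top) hbound
    _ ≤ L * |s - s'| * (2 * R) := by gcongr
    _ = 2 * R * L * |s - s'| := by ring

theorem abs_primitive_le (hκ : IsCoefficient L R κ) (p : ℝ × ℝ) : |primitive κ p| ≤ |p.2| := by
  simpa [primitive] using hκ.abs_primitive_sub_le_snd p.1 p.2 0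

theorem lipschitzWith_primitive (hκ : IsCoefficient L R κ) :
    LipschitzWith (2 * R * L + 1) (primitive κ) := by
  refine LipschitzWith.of_dist_le_mul fun p q => ?_
  have hfst : |p.1 - q.1| ≤ dist p q := le_max_left _ _
  have hsnd : |p.2 - q.2| ≤ dist p q := le_max_right _ _
  calc dist (primitive κ p) (primitive κ q)
      ≤ |primitive κ (p.1, p.2) - primitive κ (q.1, p.2)| +
          |primitive κ (q.1, p.2) - primitive κ (q.1, q.2)| := abs_sub_le _ _ _
    _ ≤ 2 * R * L * |p.1 - q.1| + |p.2 - q.2| :=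
        add_le_add (hκ.abs_primitive_sub_le_fst _ _ _) (hκ.abs_primitive_sub_le_snd _ _ _)
    _ ≤ 2 * R * L * dist p q + dist p q := by gcongr
    _ = (2 * R * L + 1 : ℝ≥0) * dist p q := by push_cast; ring

end IsCoefficient

/-- The coordinates of the orthogonal projection to the plane spanned by `σ` and `e`. -/
noncomputable def planeCoord (e σ p : E3) : ℝ × ℝ := (inner ℝ σ p, inner ℝ e p)

theorem lipschitzWith_planeCoord {e σ : E3} (he : ‖e‖ = 1) (hσ : ‖σ‖ = 1) :
    LipschitzWith 1 (planeCoord e σ) := by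
  have hnorm : ∀ w : E3, ‖w‖ = 1 → LipschitzWith 1 (innerSL ℝ w) := fun w hw => by
    have hw' : ‖innerSL ℝ w‖₊ = 1 := NNReal.eq ((innerSL_apply_norm ℝ w).trans hw)
    exact hw' ▸ (innerSL ℝ w).lipschitz
  have hprod := (hnorm σ hσ).prodMk (hnorm e he)
  rwa [max_self] at hprod

variable {n : ℕ} [NeZero n] {K : Set (EuclideanSpace ℝ (Fin 2))} {I : Set ℝ}

/-- The function `κ` on the sheets, one coefficient for each sheet. Its product with a unit vector
orthogonal to `e` and `σ` is the vector field whose flux calibrates the leaves. -/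
noncomputable def calibration (e σ : E3) (κ : Fin n × Bool → ℝ × ℝ → ℝ)
    (x : ConeProduct n K I) : ℝ :=
  κ (sheet e x) (planeCoord e σ (dev x))

/-- A function `f` such that `df ∧ d⟨σ, ·⟩` is the calibration form with coefficient `κ`. -/
noncomputable def potential (e σ : E3) (κ : Fin n × Bool → ℝ × ℝ → ℝ) :
    ConeProduct n K I → ℝ :=
  calibration e σ fun j => primitive (κ j)

variable {u e σ : E3} {κ : Fin n × Bool → ℝ × ℝ → ℝ} {L R : ℝ≥0}

theorem abs_calibration_le (hκ : ∀ j, IsCoefficient L R (κ j)) (x : ConeProduct n K I) :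
    |calibration e σ κ x| ≤ 1 := (hκ _).abs_le_one _

theorem lipschitzWith_calibration (he : IsWallNormal e) (he1 : ‖e‖ = 1) (hσ : ‖σ‖ = 1)
    {C D : ℝ≥0} (hκ : ∀ j, LipschitzWith C (κ j)) (hD : ∀ j p, |κ j p| ≤ D * |p.2|)
    (hC0 : C ≠ 0) (hDC : D ≤ C) :
    LipschitzWith C (calibration (K := K) (I := I) e σ κ) := by
  have he1' : ‖e‖₊ = 1 := NNReal.eq he1
  exact lipschitzWith_glue (G := fun j p => κ j (planeCoord e σ p)) he
    (fun j => by simpa [Function.comp_def] using (hκ j).comp (lipschitzWith_planeCoord he1 hσ))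
    (fun j p => hD j _) (by rwa [he1', mul_one]) hC0

theorem lipschitzWith_potential (he : IsWallNormal e) (he1 : ‖e‖ = 1) (hσ : ‖σ‖ = 1)
    (hκ : ∀ j, IsCoefficient L R (κ j)) :
    LipschitzWith (2 * R * L + 1) (potential (K := K) (I := I) e σ κ) :=
  lipschitzWith_calibration (D := 1) he he1 hσ (fun j => (hκ j).lipschitzWith_primitive)
    (fun j p => by simpa using (hκ j).abs_primitive_le p) (by positivity) le_add_self

theorem abs_potential_le (hκ : ∀ j, IsCoefficient L R (κ j)) (x : ConeProduct n K I) :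
    |potential e σ κ x| ≤ |inner ℝ e (dev x)| := (hκ _).abs_primitive_le _

section Pullback

variable {E : Type*} [NormedAddCommGroup E] [NormedSpace ℝ E] {φ : E → ConeProduct n K I} {q : E}

theorem hasFDerivAt_inner_dev_comp (hd : DifferentiableAt ℝ (dev ∘ φ) q) (w : E3) :
    HasFDerivAt ((fun x => inner ℝ w (dev x)) ∘ φ)
      ((innerSL ℝ w).comp (fderiv ℝ (dev ∘ φ) q)) q :=
  (innerSL ℝ w).hasFDerivAt.comp q hd.hasFDerivAt

theorem inner_fderiv_dev_eq_zero (hd : DifferentiableAt ℝ (dev ∘ φ) q) {w : E3}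
    (h0 : HasFDerivAt ((fun x => inner ℝ w (dev x)) ∘ φ) (0 : E →L[ℝ] ℝ) q) (v : E) :
    inner ℝ w (fderiv ℝ (dev ∘ φ) q v) = 0 := by
  simpa using DFunLike.congr_fun ((hasFDerivAt_inner_dev_comp hd w).unique h0) v

theorem hasFDerivAt_potential_of_wall (hκ : ∀ j, IsCoefficient L R (κ j))
    (hq : inner ℝ e (dev (φ q)) = 0)
    (h0 : HasFDerivAt ((fun x => inner ℝ e (dev x)) ∘ φ) (0 : E →L[ℝ] ℝ) q) :
    HasFDerivAt (potential e σ κ ∘ φ) (0 : E →L[ℝ] ℝ) q := by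
  have hpq : potential e σ κ (φ q) = 0 :=
    abs_nonpos_iff.1 ((abs_potential_le hκ _).trans_eq (by rw [hq, abs_zero]))
  rw [hasFDerivAt_iff_isLittleO] at h0 ⊢
  refine (Asymptotics.IsBigO.of_bound 1 (.of_forall fun p => ?_)).trans_isLittleO h0
  simpa [hpq, hq] using abs_potential_le hκ (φ p)

theorem wedge_potential_of_wall (hf : IsFrame u e σ) (hκ : ∀ j, IsCoefficient L R (κ j))
    (hd : DifferentiableAt ℝ (dev ∘ φ) q) (hq : inner ℝ e (dev (φ q)) = 0)
    (h0 : HasFDerivAt ((fun x => inner ℝ e (dev x)) ∘ φ) (0 : E →L[ℝ] ℝ) q) (v w : E) :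
    fderiv ℝ (potential e σ κ ∘ φ) q v * fderiv ℝ ((fun x => inner ℝ σ (dev x)) ∘ φ) q w -
        fderiv ℝ (potential e σ κ ∘ φ) q w * fderiv ℝ ((fun x => inner ℝ σ (dev x)) ∘ φ) q v =
      tripleProduct (calibration e σ κ (φ q) • u) (fderiv ℝ (dev ∘ φ) q v)
        (fderiv ℝ (dev ∘ φ) q w) := by
  rw [(hasFDerivAt_potential_of_wall hκ hq h0).fderiv, tripleProduct_smul, hf.tripleProduct_normal,
    inner_fderiv_dev_eq_zero hd h0, inner_fderiv_dev_eq_zero hd h0]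
  simp

-- Freezing the coordinate `⟨σ, ·⟩` at `q` changes the potential by a function `R` with
-- `|R| ≤ C |⟨σ, dev (φ p)⟩ - ⟨σ, dev (φ q)⟩|`, whose differential is a multiple of `d⟨σ, ·⟩`.
theorem wedge_potential_of_ne (hf : IsFrame u e σ) (hκ : ∀ j, IsCoefficient L R (κ j))
    (hφ : ContinuousAt φ q) (hF : DifferentiableAt ℝ (potential e σ κ ∘ φ) q)
    (hd : DifferentiableAt ℝ (dev ∘ φ) q) (hq : inner ℝ e (dev (φ q)) ≠ 0) (v w : E) :
    fderiv ℝ (potential e σ κ ∘ φ) q v * fderiv ℝ ((fun x => inner ℝ σ (dev x)) ∘ φ) q w -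
        fderiv ℝ (potential e σ κ ∘ φ) q w * fderiv ℝ ((fun x => inner ℝ σ (dev x)) ∘ φ) q v =
      tripleProduct (calibration e σ κ (φ q) • u) (fderiv ℝ (dev ∘ φ) q v)
        (fderiv ℝ (dev ∘ φ) q w) := by
  have hT := hasFDerivAt_inner_dev_comp hd σ
  set j := sheet e (φ q)
  set s₀ := inner ℝ σ (dev (φ q))
  have hfrozen : HasFDerivAt (fun p => primitive (κ j) (s₀, inner ℝ e (dev (φ p))))
      (calibration e σ κ (φ q) • (innerSL ℝ e).comp (fderiv ℝ (dev ∘ φ) q)) q :=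
    (hasDerivAt_primitive (hκ j).lipschitz.continuous s₀ _).comp_hasFDerivAt q
      (hasFDerivAt_inner_dev_comp hd e)
  have hbound : ∀ᶠ p in 𝓝 q,
      |(potential e σ κ (φ p) - primitive (κ j) (s₀, inner ℝ e (dev (φ p)))) -
        (potential e σ κ (φ q) - primitive (κ j) (s₀, inner ℝ e (dev (φ q))))| ≤
        2 * R * L * |inner ℝ σ (dev (φ p)) - inner ℝ σ (dev (φ q))| := by
    filter_upwards [hφ.eventually (eventually_sheet_eq hf.isWallNormal hq)] with p hp
    have hrest : potential e σ κ (φ q) = primitive (κ j) (s₀, inner ℝ e (dev (φ q))) := rfl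
    rw [hrest, sub_self, sub_zero, potential, calibration, hp]
    exact (hκ j).abs_primitive_sub_le_fst _ _ _
  have hwedge := wedge_eq_zero_of_abs_sub_le (hF.hasFDerivAt.sub hfrozen) hT hbound v w
  rw [hT.fderiv, tripleProduct_smul, hf.tripleProduct_normal]
  simp only [sub_apply, smul_apply, ContinuousLinearMap.comp_apply, innerSL_apply_apply,
    smul_eq_mul] at hwedge ⊢
  linear_combination hwedge

end Pullback

theorem ae_wedge_potential (hf : IsFrame u e σ) (hκ : ∀ j, IsCoefficient L R (κ j))
    {φ : ℝ × ℝ → ConeProduct n K I} {C : ℝ≥0} (hφ : LipschitzOnWith C φ square) :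
    ∀ᵐ q ∂volume.restrict square, ∀ v w,
      fderiv ℝ (potential e σ κ ∘ φ) q v * fderiv ℝ ((fun x => inner ℝ σ (dev x)) ∘ φ) q w -
          fderiv ℝ (potential e σ κ ∘ φ) q w * fderiv ℝ ((fun x => inner ℝ σ (dev x)) ∘ φ) q v =
        tripleProduct (calibration e σ κ (φ q) • u) (fderiv ℝ (dev ∘ φ) q v)
          (fderiv ℝ (dev ∘ φ) q w) := by
  have hpotential := lipschitzWith_potential (K := K) (I := I) hf.isWallNormal hf.norm_fst
    hf.norm_snd hκ
  filter_upwards [ae_square_mem_nhds,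
    ae_differentiableAt_of_lipschitzOn_square (hpotential.comp_lipschitzOnWith hφ),
    ae_differentiableAt_of_lipschitzOn_square (lipschitzWith_dev.comp_lipschitzOnWith hφ),
    ae_hasFDerivAt_zero_of_eq_zero ((lipschitzWith_inner_dev e).comp_lipschitzOnWith hφ)]
    with q hn hF hd h0
  by_cases hq : inner ℝ e (dev (φ q)) = 0
  · exact wedge_potential_of_wall hf hκ hd hq (h0 hq)
  · exact wedge_potential_of_ne hf hκ (hφ.continuousOn.continuousAt hn) hF hd hq

theorem flux_calibration (hf : IsFrame u e σ) (hκ : ∀ j, IsCoefficient L R (κ j))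
    {S : Surface n K I} {γ : ℝ → ConeProduct n K I} (hS : S.HasBoundary γ) :
    S.flux (fun x => calibration e σ κ x • u) = ∫ t in (0 : ℝ)..1,
      potential e σ κ (γ t) * deriv ((fun x => inner ℝ σ (dev x)) ∘ γ) t := by
  rw [← hS _ _ ⟨_, lipschitzWith_potential hf.isWallNormal hf.norm_fst hf.norm_snd hκ⟩
    ⟨_, lipschitzWith_inner_dev σ⟩, Surface.flux]
  refine Finset.sum_congr rfl fun i _ => ?_
  obtain ⟨C, hC⟩ := S.lipschitz i
  congr 1
  refine integral_congr_ae ?_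
  filter_upwards [ae_wedge_potential hf hκ hC] with q hq using (hq _ _).symm

theorem continuous_calibration (hf : IsFrame u e σ) (hκ : ∀ j, IsCoefficient L R (κ j)) :
    Continuous (calibration (K := K) (I := I) e σ κ) :=
  (lipschitzWith_calibration (C := L + 1) (D := L) hf.isWallNormal hf.norm_fst hf.norm_snd
    (fun j => (hκ j).lipschitz.weaken le_self_add) (fun j => (hκ j).abs_le_mul_abs_snd)
    (by positivity) le_self_add).continuous

theorem norm_calibration_smul_le (hf : IsFrame u e σ) (hκ : ∀ j, IsCoefficient L R (κ j))
    (x : ConeProduct n K I) : ‖calibration e σ κ x • u‖ ≤ 1 := by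
  rw [norm_smul, hf.norm_normal, mul_one]
  exact abs_calibration_le hκ x

theorem ofReal_flux_calibration_le_area (hf : IsFrame u e σ)
    (hκ : ∀ j, IsCoefficient L R (κ j)) {S S' : Surface n K I} {γ : ℝ → ConeProduct n K I}
    (hS : S.HasBoundary γ) (hS' : S'.HasBoundary γ) :
    ENNReal.ofReal (S.flux fun x => calibration e σ κ x • u) ≤ S'.area := by
  rw [flux_calibration hf hκ hS, ← flux_calibration hf hκ hS']
  exact le_iSup_of_le _ (le_iSup_of_le ((continuous_calibration hf hκ).smul continuous_const)
    (le_iSup_of_le (norm_calibration_smul_le hf hκ) le_rfl))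

end Calibration

section Approximation

section Truncation

variable {ι : Type*} {z : ι → ℝ × ℝ} {h : ι → ℝ}

/-- A coefficient which approximates at the points `z i` the values `h i`. -/
noncomputable def approxCoefficient (z : ι → ℝ × ℝ) (h : ι → ℝ) (m : ℕ) (p : ℝ × ℝ) : ℝ :=
  max (-cutoff m p.2) (min (cutoff m p.2) (lipschitzEnvelope z h m p))

theorem abs_approxCoefficient_le (z : ι → ℝ × ℝ) (h : ι → ℝ) (m : ℕ) (p : ℝ × ℝ) :
    |approxCoefficient z h m p| ≤ cutoff m p.2 :=
  abs_le.2 ⟨le_max_left _ _,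
    max_le (neg_le_self (cutoff_nonneg m p.2)) (min_le_left _ _)⟩

theorem isCoefficient_approxCoefficient (hb : BddBelow (Set.range h)) (m : ℕ) :
    IsCoefficient (m + 1) (m + 1) (approxCoefficient z h m) where
  lipschitz := by
    have hcut : LipschitzWith (m + 1) fun p : ℝ × ℝ => cutoff m p.2 := by
      simpa [Function.comp_def] using (lipschitzWith_cutoff m).comp LipschitzWith.prod_snd
    have h := hcut.neg.max (hcut.min (lipschitzWith_lipschitzEnvelope (z := z) hb m))
    rwa [max_eq_left le_self_add, max_self] at h
  abs_le_one p := (abs_approxCoefficient_le z h m p).trans (cutoff_le_one m _)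
  eq_zero_of_snd_eq_zero p hp := abs_nonpos_iff.1
    ((abs_approxCoefficient_le z h m p).trans_eq (by rw [hp, cutoff_zero]))
  eq_zero_of_lt_abs_snd p hp := abs_nonpos_iff.1
    ((abs_approxCoefficient_le z h m p).trans_eq (cutoff_eq_zero_of_lt (by simpa using hp)))

theorem tendsto_approxCoefficient (h1 : ∀ i, |h i| ≤ 1) {i : ι} (hz : (z i).2 ≠ 0)
    (hi : Tendsto h (comap z (𝓝 (z i))) (𝓝 (h i))) :
    Tendsto (fun m => approxCoefficient z h m (z i)) atTop (𝓝 (h i)) := by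
  have hb : BddBelow (Set.range h) := ⟨-1, by rintro _ ⟨i, rfl⟩; exact (abs_le.1 (h1 i)).1⟩
  have hcut := tendsto_cutoff hz
  have hlim := hcut.neg.max (hcut.min (tendsto_lipschitzEnvelope hb hi))
  rwa [min_eq_right (abs_le.1 (h1 i)).2, max_eq_right (abs_le.1 (h1 i)).1] at hlim

end Truncation

variable {n : ℕ} [NeZero n] {K : Set (EuclideanSpace ℝ (Fin 2))} {I : Set ℝ}
  {u e σ : E3} {c : ℝ}

theorem isInducing_planeCoord_dev (hS : Convex ℝ (solid K I)) (hf : IsFrame u e σ)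
    (j : Fin n × Bool) : IsInducing
      fun x : {x : ConeProduct n K I // x ∈ level u c ∧ sheet e x = j ∧ inner ℝ e (dev x) ≠ 0} =>
        planeCoord e σ (dev x.1) := by
  have hlip := (lipschitzWith_planeCoord hf.norm_fst hf.norm_snd).comp
    ((lipschitzWith_dev (n := n) (K := K) (I := I)).comp (LipschitzWith.subtype_val
      {x | x ∈ level u c ∧ sheet e x = j ∧ inner ℝ e (dev x) ≠ 0}))
  refine (AntilipschitzWith.isUniformInducing (K := 2) ?_ hlip.uniformContinuous).isInducing
  rintro ⟨x, hx, hxj, hxe⟩ ⟨y, hy, hyj, hye⟩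
  have hu : inner ℝ u (dev x - dev y) = 0 := by
    rw [inner_sub_right, show inner ℝ u (dev x) = c from hx, show inner ℝ u (dev y) = c from hy,
      sub_self]
  have hdist : dist (dev x) (dev y) ≤
      2 * dist (planeCoord e σ (dev x)) (planeCoord e σ (dev y)) := by
    have hsum := hf.norm_le_of_orthogonal hu
    rw [inner_sub_right, inner_sub_right, ← dist_eq_norm] at hsum
    have hσ : |inner ℝ σ (dev x) - inner ℝ σ (dev y)| ≤
        dist (planeCoord e σ (dev x)) (planeCoord e σ (dev y)) := le_max_left _ _
    have he : |inner ℝ e (dev x) - inner ℝ e (dev y)| ≤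
        dist (planeCoord e σ (dev x)) (planeCoord e σ (dev y)) := le_max_right _ _
    linarith
  have hedist : edist (dev x) (dev y) ≤
      (2 : ℝ≥0) * edist (planeCoord e σ (dev x)) (planeCoord e σ (dev y)) := by
    rw [edist_nndist, edist_nndist]
    exact_mod_cast hdist
  exact (edist_le_of_sheet_eq hS hf.isWallNormal (hxj.trans hyj.symm) hxe hye).trans hedist

theorem exists_tendsto_calibration (hS : Convex ℝ (solid K I)) (hf : IsFrame u e σ) (c : ℝ)
    {h : ConeProduct n K I → ℝ} (hh : Continuous h) (h1 : ∀ x, |h x| ≤ 1) :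
    ∃ κ : ℕ → Fin n × Bool → ℝ × ℝ → ℝ,
      (∀ (m : ℕ) j, IsCoefficient (m + 1) (m + 1) (κ m j)) ∧
        ∀ x ∈ level u c, inner ℝ e (dev x) ≠ 0 →
          Tendsto (fun m => calibration e σ (κ m) x) atTop (𝓝 (h x)) := by
  refine ⟨fun m j => approxCoefficient (fun x :
    {x : ConeProduct n K I // x ∈ level u c ∧ sheet e x = j ∧ inner ℝ e (dev x) ≠ 0} =>
      planeCoord e σ (dev x.1)) (fun x => h x.1) m, fun m j => ?_, fun x hx hxe => ?_⟩
  · refine isCoefficient_approxCoefficient ⟨-1, ?_⟩ m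
    rintro _ ⟨x, rfl⟩
    exact (abs_le.1 (h1 x)).1
  · have hind := isInducing_planeCoord_dev hS hf (c := c) (sheet e x)
    have hcont := (hh.comp continuous_subtype_val).tendsto
      (⟨x, hx, rfl, hxe⟩ : {y // y ∈ level u c ∧ sheet e y = sheet e x ∧ inner ℝ e (dev y) ≠ 0})
    rw [hind.nhds_eq_comap] at hcont
    have happrox := tendsto_approxCoefficient (h := h ∘ Subtype.val) (fun y => h1 _) hxe hcont
    exact happrox

end Approximation

section Area

variable {n : ℕ} [NeZero n] {K : Set (EuclideanSpace ℝ (Fin 2))} {I : Set ℝ}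

theorem continuous_tripleProduct :
    Continuous fun p : E3 × E3 × E3 => tripleProduct p.1 p.2.1 p.2.2 := by
  simp only [tripleProduct_eq]
  fun_prop

theorem Surface.tendsto_flux (S : Surface n K I) {V : ℕ → ConeProduct n K I → E3}
    {W : ConeProduct n K I → E3} (hV : ∀ m, Continuous (V m)) (h1 : ∀ m x, ‖V m x‖ ≤ 1)
    (hlim : ∀ i, ∀ᵐ q ∂volume.restrict square,
      Tendsto (fun m => tripleProduct (V m (S.patch i q)) (fderiv ℝ (dev ∘ S.patch i) q (1, 0))
        (fderiv ℝ (dev ∘ S.patch i) q (0, 1))) atTop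
      (𝓝 (tripleProduct (W (S.patch i q)) (fderiv ℝ (dev ∘ S.patch i) q (1, 0))
        (fderiv ℝ (dev ∘ S.patch i) q (0, 1))))) :
    Tendsto (fun m => S.flux (V m)) atTop (𝓝 (S.flux W)) := by
  refine tendsto_finsetSum _ fun i _ => Tendsto.const_mul _ ?_
  obtain ⟨C, hC⟩ := S.lipschitz i
  refine tendsto_integral_of_dominated_convergence (fun _ => (C : ℝ) * C) (fun m => ?_)
    (integrableOn_const isCompact_square.measure_ne_top) (fun m => ?_) (hlim i)
  · have hmeas := fun v : ℝ × ℝ => (measurable_fderiv_apply_const ℝ (dev ∘ S.patch i)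
      v).aestronglyMeasurable (μ := volume.restrict square)
    have hVmeas := ((hV m).comp_continuousOn hC.continuousOn).aestronglyMeasurable
      isCompact_square.measurableSet (μ := volume)
    have h := continuous_tripleProduct.comp_aestronglyMeasurable
      (hVmeas.prodMk ((hmeas (1, 0)).prodMk (hmeas (0, 1))))
    exact h
  · filter_upwards [ae_square_mem_nhds] with q hq
    have hderiv : ∀ v : ℝ × ℝ, ‖v‖ = 1 → ‖fderiv ℝ (dev ∘ S.patch i) q v‖ ≤ C := fun v hv => by
      have hop := norm_fderiv_le_of_lipschitzOn ℝ hq (lipschitzWith_dev.comp_lipschitzOnWith hC)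
      simpa [hv] using ContinuousLinearMap.le_of_opNorm_le _ hop v
    calc _ ≤ ‖V m (S.patch i q)‖ * (‖fderiv ℝ (dev ∘ S.patch i) q (1, 0)‖ *
          ‖fderiv ℝ (dev ∘ S.patch i) q (0, 1)‖) := abs_tripleProduct_le _ _ _
      _ ≤ 1 * (C * C) := by
          gcongr
          exacts [h1 m _, hderiv _ (by simp), hderiv _ (by simp)]
      _ = C * C := one_mul _

theorem ae_tendsto_tripleProduct {u e σ : E3} {c : ℝ} (hf : IsFrame u e σ)
    {φ : ℝ × ℝ → ConeProduct n K I} {C : ℝ≥0} (hφ : LipschitzOnWith C φ square)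
    (hlevel : Set.MapsTo φ square (level u c)) {V : ConeProduct n K I → E3}
    {a : ℕ → ConeProduct n K I → ℝ} (ha : ∀ x ∈ level u c, inner ℝ e (dev x) ≠ 0 →
      Tendsto (fun m => a m x) atTop (𝓝 (inner ℝ (V x) u))) :
    ∀ᵐ q ∂volume.restrict square,
      Tendsto (fun m => tripleProduct (a m (φ q) • u) (fderiv ℝ (dev ∘ φ) q (1, 0))
        (fderiv ℝ (dev ∘ φ) q (0, 1))) atTop
      (𝓝 (tripleProduct (V (φ q)) (fderiv ℝ (dev ∘ φ) q (1, 0))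
        (fderiv ℝ (dev ∘ φ) q (0, 1)))) := by
  filter_upwards [ae_square_mem_nhds, ae_restrict_mem isCompact_square.measurableSet,
    ae_differentiableAt_of_lipschitzOn_square (lipschitzWith_dev.comp_lipschitzOnWith hφ),
    ae_hasFDerivAt_zero_of_eq_zero ((lipschitzWith_inner_dev e).comp_lipschitzOnWith hφ)]
    with q hn hq hd hwall
  have hconst : HasFDerivAt ((fun x => inner ℝ u (dev x)) ∘ φ) (0 : ℝ × ℝ →L[ℝ] ℝ) q :=
    (hasFDerivAt_const c q).congr_of_eventuallyEq (mem_of_superset hn hlevel)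
  have horth := inner_fderiv_dev_eq_zero hd hconst
  simp only [tripleProduct_smul, hf.tripleProduct_of_orthogonal (horth _) (horth _) (V _)]
  by_cases he : inner ℝ e (dev (φ q)) = 0
  · rw [hf.tripleProduct_normal, inner_fderiv_dev_eq_zero hd (hwall he),
      inner_fderiv_dev_eq_zero hd (hwall he)]
    simp
  · exact (ha _ (hlevel hq) he).mul_const _

theorem level_smul (r : ℝ) (hr : r ≠ 0) (ν : E3) (c : ℝ) :
    (level (r • ν) (r * c) : Set (ConeProduct n K I)) = level ν c := by
  ext x
  simp [level, inner_smul_left, hr]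

theorem area_le_area (hS : Convex ℝ (solid K I)) {ν : E3} (hν : ν ≠ 0) {c : ℝ}
    {S S' : Surface n K I} (hlevel : S.carrier ⊆ level ν c) {γ : ℝ → ConeProduct n K I}
    (hb : S.HasBoundary γ) (hb' : S'.HasBoundary γ) : S.area ≤ S'.area := by
  refine iSup_le fun V => iSup_le fun hV => iSup_le fun hV1 => ?_
  have hu : ‖‖ν‖⁻¹ • ν‖ = 1 := norm_smul_inv_norm hν
  rw [← level_smul ‖ν‖⁻¹ (inv_ne_zero (norm_ne_zero_iff.2 hν))] at hlevel
  generalize ‖ν‖⁻¹ • ν = u at hu hlevel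
  obtain ⟨e, σ, hf⟩ := exists_isFrame hu
  have hinner : ∀ x, |inner ℝ (V x) u| ≤ 1 := fun x =>
    (abs_real_inner_le_norm _ _).trans (by rw [hu, mul_one]; exact hV1 x)
  obtain ⟨κ, hκ, hlim⟩ :=
    exists_tendsto_calibration hS hf (‖ν‖⁻¹ * c) (hV.inner continuous_const) hinner
  have hflux : Tendsto (fun m => S.flux fun x => calibration e σ (κ m) x • u) atTop
      (𝓝 (S.flux V)) := by
    refine S.tendsto_flux (fun m => (continuous_calibration hf (hκ m)).smul continuous_const)
      (fun m => norm_calibration_smul_le hf (hκ m)) fun i => ?_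
    obtain ⟨C, hC⟩ := S.lipschitz i
    exact ae_tendsto_tripleProduct hf hC
      (fun q hq => hlevel (Set.mem_iUnion.2 ⟨i, q, hq, rfl⟩)) hlim
  exact le_of_tendsto (ENNReal.tendsto_ofReal hflux)
    (.of_forall fun m => ofReal_flux_calibration_le_area hf (hκ m) hb hb')

end Area

section Spanning

/-! ### Spanning surfaces inside the leaves -/

theorem mem_connectedComponentIn_of_continuous {X T : Type*} [TopologicalSpace X]
    [TopologicalSpace T] [PreconnectedSpace T] {F : T → X} (hF : Continuous F) {s : Set X}
    (hs : ∀ t, F t ∈ s) {x₀ : X} {t₀ : T} (h₀ : F t₀ ∈ connectedComponentIn s x₀) (t : T) :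
    F t ∈ connectedComponentIn s x₀ := by
  rw [connectedComponentIn_eq h₀]
  exact (isPreconnected_range hF).subset_connectedComponentIn (Set.mem_range_self t₀)
    (Set.range_subset_iff.2 hs) (Set.mem_range_self t)

theorem edist_lineMap_left {E : Type*} [NormedAddCommGroup E] [NormedSpace ℝ E] (p q o : E)
    (t : unitInterval) :
    edist (AffineMap.lineMap p o (t : ℝ)) (AffineMap.lineMap q o (t : ℝ)) =
      ENNReal.ofReal (1 - t) * edist p q := by
  rw [edist_dist, edist_dist, ← ENNReal.ofReal_mul (unitInterval.one_minus_nonneg t),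
    AffineMap.lineMap_apply_module, AffineMap.lineMap_apply_module, dist_add_right, dist_smul₀,
    Real.norm_of_nonneg (unitInterval.one_minus_nonneg t)]

theorem ofReal_one_sub_mul_le (t : unitInterval) (d : ℝ≥0∞) : ENNReal.ofReal (1 - t) * d ≤ d :=
  mul_le_of_le_one_left zero_le (ENNReal.ofReal_le_one.2 (unitInterval.one_minus_le_one t))

variable {n : ℕ} {K : Set (EuclideanSpace ℝ (Fin 2))} {I : Set ℝ}

section Contraction

variable [NeZero n]

/-- A contraction of `L` which lifts the straight contraction of `ℝ³` to the point `o`. Distances in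
`L` may be infinite, so the final map is constant only on points at finite distance. -/
structure IsContraction (L : Set (ConeProduct n K I)) (o : E3)
    (H : unitInterval → ConeProduct n K I → ConeProduct n K I) : Prop where
  mapsTo : ∀ t, Set.MapsTo (H t) L L
  zero : ∀ x ∈ L, H 0 x = x
  one : ∀ x ∈ L, ∀ y ∈ L, edist x y ≠ ⊤ → H 1 x = H 1 y
  lipschitz_space : ∀ t, LipschitzOnWith 1 (H t) L
  lipschitz_time : ∀ x ∈ L, LipschitzWith (nndist (dev x) o) fun t => H t x

variable {L : Set (ConeProduct n K I)} {o : E3}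
  {H : unitInterval → ConeProduct n K I → ConeProduct n K I} {γ : ℝ → ConeProduct n K I} {C : ℝ≥0}

theorem IsContraction.exists_lipschitzWith_comp (hH : IsContraction L o H)
    (hγ : LipschitzOnWith C γ (Set.Icc 0 1)) (hγL : ∀ t ∈ Set.Icc (0 : ℝ) 1, γ t ∈ L) :
    ∃ B, LipschitzWith B fun q : unitInterval × unitInterval => H q.2 (γ q.1) := by
  have hlip : LipschitzWith C fun s : unitInterval => γ s := hγ.to_restrict
  have hdist : Continuous fun s : unitInterval => nndist (dev (γ s)) o :=
    (lipschitzWith_dev.continuous.comp hlip.continuous).nndist continuous_const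
  obtain ⟨B, hB⟩ := (isCompact_range hdist).bddAbove
  exact ⟨_, LipschitzWith.uncurry (f := fun (s : unitInterval) t => H t (γ s))
    (fun t => lipschitzOnWith_univ.1
      ((hH.lipschitz_space t).comp hlip.lipschitzOnWith fun s _ => hγL s s.2))
    (fun s => (hH.lipschitz_time _ (hγL s s.2)).weaken (hB (Set.mem_range_self s)))⟩

theorem IsContraction.exists_surface (hH : IsContraction L o H)
    (hγ : LipschitzOnWith C γ (Set.Icc 0 1)) (hclosed : γ 0 = γ 1)
    (hγL : ∀ t ∈ Set.Icc (0 : ℝ) 1, γ t ∈ L) :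
    ∃ S : Surface n K I, S.carrier ⊆ L ∧ S.HasBoundary γ := by
  obtain ⟨B, hB⟩ := hH.exists_lipschitzWith_comp hγ hγL
  let proj : ℝ → unitInterval := Set.projIcc 0 1 zero_le_one
  have hproj : LipschitzWith 1 proj := LipschitzWith.projIcc zero_le_one
  have hΦ := hB.comp ((hproj.comp LipschitzWith.prod_fst).prodMk
    (hproj.comp LipschitzWith.prod_snd))
  have hval : ∀ t ∈ Set.Icc (0 : ℝ) 1, (proj t : ℝ) = t := fun t ht =>
    congrArg Subtype.val (Set.projIcc_of_mem _ ht)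
  have h0 : proj 0 = 0 := Set.projIcc_left zero_le_one
  have h1 : proj 1 = 1 := Set.projIcc_right zero_le_one
  refine ⟨Surface.single _ ⟨_, hΦ.lipschitzOnWith⟩, ?_, Surface.hasBoundary_single _
    (p := H 1 (γ 0)) (fun t ht => ?_) (fun t ht => ?_) fun r _ => ?_⟩
  · rw [Surface.carrier_single]
    rintro _ ⟨q, -, rfl⟩
    exact hH.mapsTo _ (hγL _ (proj q.1).2)
  · simp [h0, hval t ht, hH.zero _ (hγL t ht)]
  · have h0' := Set.left_mem_Icc.2 (zero_le_one (α := ℝ))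
    simp only [Function.comp, h1, hval t ht]
    exact hH.one _ (hγL t ht) _ (hγL 0 h0') (ne_top_of_le_ne_top
      (ENNReal.mul_ne_top ENNReal.coe_ne_top (edist_ne_top _ _)) (hγ ht h0'))
  · simp [h0, h1, hclosed]

end Contraction

section Homothety

/-! ### The leaves that meet the axis -/

/-- Points of the axis of `K × I` with respect to which `K × I` is star-shaped. -/
structure IsAxisCenter (K : Set (EuclideanSpace ℝ (Fin 2))) (I : Set ℝ) (o : E3) : Prop where
  starConvex : StarConvex ℝ o (solid K I)
  zero_eq : o 0 = 0
  one_eq : o 1 = 0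

theorem isAxisCenter_of_mem (hK : Convex ℝ K) (hI : I.OrdConnected)
    (hK0 : (0 : EuclideanSpace ℝ (Fin 2)) ∈ K) {z : ℝ} (hz : z ∈ I) :
    IsAxisCenter K I !₂[0, 0, z] where
  starConvex := by
    refine (convex_solid hK hI).starConvex ⟨?_, by simpa using hz⟩
    convert hK0 using 1
    ext i
    fin_cases i <;> simp
  zero_eq := by simp
  one_eq := by simp

theorem lineMap_apply_coord (p q : E3) (t : ℝ) (i : Fin 3) :
    (AffineMap.lineMap p q t : E3) i = (1 - t) * p i + t * q i := by
  simp [AffineMap.lineMap_apply_module]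

theorem IsAxisCenter.lineMap_mem_solid {o : E3} (ho : IsAxisCenter K I o) {p : E3}
    (hp : p ∈ solid K I) (t : unitInterval) : AffineMap.lineMap p o (t : ℝ) ∈ solid K I := by
  rw [AffineMap.lineMap_apply_module, add_comm]
  exact ho.starConvex hp (unitInterval.nonneg t) (unitInterval.one_minus_nonneg t)
    (add_sub_cancel _ _)

/-- The homothety of ratio `1 - t` with centre on the axis, on each copy. -/
noncomputable def CutPoint.contract {o : E3} (ho : IsAxisCenter K I o) (t : unitInterval)
    (a : CutPoint n K I) : CutPoint n K I where
  copy := a.copy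
  upper := a.upper
  pos := AffineMap.lineMap a.pos o (t : ℝ)
  horizontal_mem := (ho.lineMap_mem_solid a.pos_mem_solid t).1
  vertical_mem := (ho.lineMap_mem_solid a.pos_mem_solid t).2
  side := by
    have h := a.side
    rw [lineMap_apply_coord, ho.one_eq, mul_zero, add_zero]
    split_ifs at h ⊢
    · exact mul_nonneg (unitInterval.one_minus_nonneg t) h
    · exact mul_nonpos_of_nonneg_of_nonpos (unitInterval.one_minus_nonneg t) h

variable {o : E3} (ho : IsAxisCenter K I o)

theorem GluedInCopy.contract {a b : CutPoint n K I} (h : GluedInCopy a b) (t : unitInterval) :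
    GluedInCopy (a.contract ho t) (b.contract ho t) := by
  obtain ⟨hp, hc, h1, h0⟩ := h
  refine ⟨congrArg (AffineMap.lineMap · o (t : ℝ)) hp, hc, ?_, ?_⟩ <;>
    simp only [CutPoint.contract, lineMap_apply_coord, ho.zero_eq, ho.one_eq, h1, mul_zero,
      add_zero]
  exact mul_nonpos_of_nonneg_of_nonpos (unitInterval.one_minus_nonneg t) h0

variable [NeZero n]

theorem GluedToNext.contract {a b : CutPoint n K I} (h : GluedToNext a b) (t : unitInterval) :
    GluedToNext (a.contract ho t) (b.contract ho t) := by
  obtain ⟨hp, ha, hb, hc, h1, h0⟩ := h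
  refine ⟨congrArg (AffineMap.lineMap · o (t : ℝ)) hp, ha, hb, hc, ?_, ?_⟩ <;>
    simp only [CutPoint.contract, lineMap_apply_coord, ho.zero_eq, ho.one_eq, h1, mul_zero,
      add_zero]
  exact mul_nonneg (unitInterval.one_minus_nonneg t) h0

theorem BrokenPath.contract (t : unitInterval) {a b : CutPoint n K I} {l : ℝ≥0∞}
    (h : BrokenPath a b l) :
    BrokenPath (a.contract ho t) (b.contract ho t) (ENNReal.ofReal (1 - t) * l) := by
  induction h with
  | segment a b hc hu =>
    rw [← edist_lineMap_left]
    exact .segment (a.contract ho t) (b.contract ho t) hc hu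
  | inCopy a b h => simpa using .inCopy _ _ (h.contract ho t)
  | toNext a b h => simpa using .toNext _ _ (h.contract ho t)
  | symm _ ih => exact ih.symm
  | trans _ _ hab hbc =>
    rw [mul_add]
    exact hab.trans hbc

/-- The homothety of the cone product of ratio `1 - t` with centre on the axis. -/
noncomputable def contract (t : unitInterval) (x : ConeProduct n K I) : ConeProduct n K I :=
  SeparationQuotient.mk ((Quotient.out x : CutPoint n K I).contract ho t)

theorem dev_contract (t : unitInterval) (x : ConeProduct n K I) :
    dev (contract ho t x) = AffineMap.lineMap (dev x) o (t : ℝ) := by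
  rw [← pos_out x]
  rfl

theorem contract_zero (x : ConeProduct n K I) : contract ho 0 x = x := by
  have h : (Quotient.out x : CutPoint n K I).contract ho 0 = Quotient.out x := by
    simp [CutPoint.contract]
  rw [contract, h, mk_out]

theorem lipschitzWith_contract (t : unitInterval) :
    LipschitzWith 1 (contract ho t : ConeProduct n K I → ConeProduct n K I) := fun x y => by
  rw [contract, contract, SeparationQuotient.edist_mk, ENNReal.coe_one, one_mul, ← edist_out x y]
  exact le_sInf fun l hl => (sInf_le (hl.contract ho t)).trans (ofReal_one_sub_mul_le t l)

theorem contract_one_eq {x y : ConeProduct n K I} (h : edist x y ≠ ⊤) :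
    contract ho 1 x = contract ho 1 y := by
  rw [← edist_out x y] at h
  obtain ⟨l, hl, -⟩ := sInf_lt_iff.1 h.lt_top
  have hpath := hl.contract ho 1
  rw [Set.Icc.coe_one, sub_self, ENNReal.ofReal_zero, zero_mul] at hpath
  refine edist_le_zero.1 ?_
  rw [contract, contract, SeparationQuotient.edist_mk]
  exact sInf_le hpath

theorem lipschitzWith_contract_apply (x : ConeProduct n K I) :
    LipschitzWith (nndist (dev x) o) fun t => contract ho t x := fun t t' => by
  rw [← pos_out x]
  change edist (SeparationQuotient.mk _) (SeparationQuotient.mk _) ≤ _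
  rw [SeparationQuotient.edist_mk]
  exact (sInf_le (.segment ((Quotient.out x : CutPoint n K I).contract ho t)
    ((Quotient.out x : CutPoint n K I).contract ho t') rfl rfl)).trans
      (lipschitzWith_lineMap _ o (t : ℝ) t')

theorem isContraction_contract {L : Set (ConeProduct n K I)}
    (hL : ∀ t, Set.MapsTo (contract ho t) L L) : IsContraction L o (contract ho) where
  mapsTo := hL
  zero x _ := contract_zero ho x
  one _ _ _ _ h := contract_one_eq ho h
  lipschitz_space t := (lipschitzWith_contract ho t).lipschitzOnWith
  lipschitz_time x _ := lipschitzWith_contract_apply ho x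

theorem contract_mem_level {ν : E3} {x : ConeProduct n K I} {c : ℝ} (hc : inner ℝ ν o = c)
    (hx : x ∈ level ν c) (t : unitInterval) : contract ho t x ∈ level ν c := by
  have hx' : inner ℝ ν (dev x) = c := hx
  change inner ℝ ν (dev _) = c
  rw [dev_contract, AffineMap.lineMap_apply_module, inner_add_right, inner_smul_right,
    inner_smul_right, hc, hx']
  ring

theorem contract_mem_component {ν : E3} {c : ℝ} (hc : inner ℝ ν o = c) {x₀ : ConeProduct n K I}
    (t : unitInterval) : Set.MapsTo (contract ho t) (connectedComponentIn (level ν c) x₀)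
      (connectedComponentIn (level ν c) x₀) := fun x hx =>
  mem_connectedComponentIn_of_continuous (F := fun t => contract ho t x) (t₀ := 0)
    (lipschitzWith_contract_apply ho x).continuous
    (contract_mem_level ho hc (connectedComponentIn_subset _ _ hx))
    (by rwa [contract_zero]) t

theorem contract_mem_axis_iff {t : unitInterval} {x : ConeProduct n K I} :
    contract ho t x ∈ axis ↔ t = 1 ∨ x ∈ axis := by
  have ht : 1 - (t : ℝ) = 0 ↔ t = 1 := by
    rw [sub_eq_zero, eq_comm, ← Set.Icc.coe_one, Subtype.coe_inj]
  simp only [axis, Set.mem_ofPred_eq, dev_contract, lineMap_apply_coord, ho.zero_eq, ho.one_eq,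
    mul_zero, add_zero, mul_eq_zero, ht, ← or_and_left]

theorem contract_mem_halfPlane {ν : E3} {c : ℝ} (hc : inner ℝ ν o = c) {x₀ : ConeProduct n K I}
    {t : unitInterval} (ht : t < 1) :
    Set.MapsTo (contract ho t) (connectedComponentIn (level ν c \ axis) x₀)
      (connectedComponentIn (level ν c \ axis) x₀) := fun x hx => by
  obtain ⟨hlevel, haxis⟩ := connectedComponentIn_subset _ _ hx
  have : PreconnectedSpace (Set.Iio (1 : unitInterval)) :=
    Subtype.preconnectedSpace isPreconnected_Iio
  refine mem_connectedComponentIn_of_continuous (T := Set.Iio (1 : unitInterval))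
    (F := fun s => contract ho s x) (s := level ν c \ axis) (t₀ := ⟨0, Set.mem_Iio.2 zero_lt_one⟩)
    ((lipschitzWith_contract_apply ho x).continuous.comp continuous_subtype_val)
    (fun s => ⟨contract_mem_level ho hc hlevel s, ?_⟩) (by rwa [contract_zero]) ⟨t, ht⟩
  rw [contract_mem_axis_iff]
  exact not_or.2 ⟨s.2.ne, haxis⟩

end Homothety

section Lift

variable [NeZero n]

/-! ### The leaves that miss the axis -/

variable (K I) in
/-- The part of the plane `⟨ν, p⟩ = c` in `K × I`. -/
def slice (ν : E3) (c : ℝ) : Set E3 := {p ∈ solid K I | inner ℝ ν p = c}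

theorem convex_slice (hS : Convex ℝ (solid K I)) (ν : E3) (c : ℝ) : Convex ℝ (slice K I ν c) :=
  hS.inter (convex_hyperplane (innerₗ E3 ν).isLinear c)

theorem dev_mem_slice {ν : E3} {c : ℝ} {x : ConeProduct n K I} (hx : x ∈ level ν c) :
    dev x ∈ slice K I ν c := ⟨dev_mem_solid x, hx⟩

theorem pos_of_convex_of_ne_zero {E : Type*} [AddCommGroup E] [Module ℝ E] [TopologicalSpace E]
    [IsTopologicalAddGroup E] [ContinuousSMul ℝ E] {s : Set E} (hs : Convex ℝ s) {f : E → ℝ}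
    (hf : Continuous f) (hne : ∀ p ∈ s, f p ≠ 0) {p q : E} (hp : p ∈ s) (hq : q ∈ s)
    (h : 0 < f p) : 0 < f q := by
  by_contra hneg
  obtain ⟨r, hr, hr0⟩ := exists_mem_segment_apply_eq_zero hf h.le (not_lt.1 hneg)
  exact hne r (hs.segment_subset hp hq hr) hr0

theorem exists_cutPoint_sheet_eq (e : E3) {p : E3} (hp : p ∈ solid K I) (k : Fin n) :
    ∃ a : CutPoint n K I, a.pos = p ∧ a.sheet e = (k, decide (0 < inner ℝ e p)) := by
  by_cases h1 : 0 ≤ p 1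
  · exact ⟨⟨k, true, p, hp.1, hp.2, by simpa using h1⟩, rfl, by simp [CutPoint.sheet]⟩
  · refine ⟨⟨if 0 < inner ℝ e p then k + 1 else k, false, p, hp.1, hp.2,
      by simpa using (not_le.1 h1).le⟩, rfl, ?_⟩
    by_cases h : 0 < inner ℝ e p <;> simp [CutPoint.sheet, h]

theorem exists_dev_eq_sheet_eq {e : E3} (he : IsWallNormal e) {x : ConeProduct n K I} {p : E3}
    (hp : p ∈ solid K I) (hpe : inner ℝ e p ≠ 0)
    (hiff : 0 < inner ℝ e (dev x) ↔ 0 < inner ℝ e p) :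
    ∃ y : ConeProduct n K I, dev y = p ∧ sheet e y = sheet e x := by
  obtain ⟨a, rfl, ha⟩ := exists_cutPoint_sheet_eq e hp (sheet e x).1
  refine ⟨SeparationQuotient.mk a, rfl, ?_⟩
  rw [sheet_mk he hpe, ha]
  refine Prod.ext rfl ?_
  simp only [sheet, CutPoint.sheet, pos_out, hiff]

variable {e ν : E3} {c : ℝ}

theorem continuousOn_sheet (he : IsWallNormal e) (hne : ∀ p ∈ slice K I ν c, inner ℝ e p ≠ 0) :
    ContinuousOn (sheet e : ConeProduct n K I → Fin n × Bool) (level ν c) := fun _ hx =>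
  (continuousAt_const.congr ((eventually_sheet_eq he (hne _ (dev_mem_slice hx))).mono
    fun _ hy => hy.symm)).continuousWithinAt

theorem exists_lift (hS : Convex ℝ (solid K I)) (he : IsWallNormal e)
    (hne : ∀ p ∈ slice K I ν c, inner ℝ e p ≠ 0) {o : E3} (ho : o ∈ slice K I ν c)
    (t : unitInterval) {x : ConeProduct n K I} (hx : x ∈ level ν c) : ∃ y : ConeProduct n K I,
      y ∈ level ν c ∧ dev y = AffineMap.lineMap (dev x) o (t : ℝ) ∧ sheet e y = sheet e x := by
  have hslice := convex_slice hS ν c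
  have hp : AffineMap.lineMap (dev x) o (t : ℝ) ∈ slice K I ν c :=
    hslice.lineMap_mem (dev_mem_slice hx) ho t.2
  have hf : Continuous fun p : E3 => inner ℝ e p := by fun_prop
  obtain ⟨y, hy, hsheet⟩ := exists_dev_eq_sheet_eq he (x := x) hp.1 (hne _ hp)
    ⟨pos_of_convex_of_ne_zero hslice hf hne (dev_mem_slice hx) hp,
      pos_of_convex_of_ne_zero hslice hf hne hp (dev_mem_slice hx)⟩
  exact ⟨y, by simpa only [level, Set.mem_ofPred_eq, hy] using hp.2, hy, hsheet⟩

theorem edist_le_of_mem_level (hS : Convex ℝ (solid K I)) (he : IsWallNormal e)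
    (hne : ∀ p ∈ slice K I ν c, inner ℝ e p ≠ 0) {x y : ConeProduct n K I} (hx : x ∈ level ν c)
    (hy : y ∈ level ν c) (hxy : sheet e x = sheet e y) : edist x y ≤ edist (dev x) (dev y) :=
  edist_le_of_sheet_eq hS he hxy (hne _ (dev_mem_slice hx)) (hne _ (dev_mem_slice hy))

theorem exists_isContraction_of_ne_zero (hS : Convex ℝ (solid K I)) (he : IsWallNormal e)
    (hne : ∀ p ∈ slice K I ν c, inner ℝ e p ≠ 0) {o : E3} (ho : o ∈ slice K I ν c)
    (x₀ : ConeProduct n K I) : ∃ H, IsContraction (connectedComponentIn (level ν c) x₀) o H := by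
  have : Nonempty (ConeProduct n K I) := ⟨x₀⟩
  choose! H hlevel hdev hsheet using fun t (x : ConeProduct n K I) (hx : x ∈ level ν c) =>
    exists_lift hS he hne ho t hx
  have hzero : ∀ x ∈ level ν c, H 0 x = x := fun x hx => edist_le_zero.1 <| by
    simpa [hdev 0 x hx] using edist_le_of_mem_level hS he hne (hlevel 0 x hx) hx (hsheet 0 x hx)
  have htime : ∀ x ∈ level ν c, LipschitzWith (nndist (dev x) o) fun t => H t x :=
    fun x hx t t' => by
      have h := edist_le_of_mem_level hS he hne (hlevel t x hx) (hlevel t' x hx)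
        ((hsheet t x hx).trans (hsheet t' x hx).symm)
      rw [hdev t x hx, hdev t' x hx] at h
      exact h.trans (lipschitzWith_lineMap (dev x) o (t : ℝ) t')
  have hsub : connectedComponentIn (level ν c) x₀ ⊆ level ν c := connectedComponentIn_subset _ _
  have hspace : ∀ t, ∀ x ∈ connectedComponentIn (level ν c) x₀,
      ∀ y ∈ connectedComponentIn (level ν c) x₀,
        edist (H t x) (H t y) ≤ ENNReal.ofReal (1 - t) * edist (dev x) (dev y) :=
    fun t x hx y hy => by
      have hxy : sheet e x = sheet e y := isPreconnected_connectedComponentIn.constant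
        ((continuousOn_sheet he hne).mono hsub) hx hy
      rw [← edist_lineMap_left _ _ o, ← hdev t x (hsub hx), ← hdev t y (hsub hy)]
      exact edist_le_of_mem_level hS he hne (hlevel t x (hsub hx)) (hlevel t y (hsub hy))
        ((hsheet t x (hsub hx)).trans (hxy.trans (hsheet t y (hsub hy)).symm))
  refine ⟨H, fun t x hx => ?_, fun x hx => hzero x (hsub hx), fun x hx y hy _ => ?_,
    fun t x hx y hy => ?_, fun x hx => htime x (hsub hx)⟩
  · exact mem_connectedComponentIn_of_continuous (F := fun t => H t x) (t₀ := 0)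
      (htime x (hsub hx)).continuous (fun t => hlevel t x (hsub hx))
      (by rwa [hzero x (hsub hx)]) t
  · exact edist_le_zero.1 (by simpa using hspace 1 x hx y hy)
  · exact ((hspace t x hx y hy).trans (ofReal_one_sub_mul_le t _)).trans (lipschitzWith_dev x y)

end Lift

end Spanning

section Leaves

variable {n : ℕ} {K : Set (EuclideanSpace ℝ (Fin 2))} {I : Set ℝ} [NeZero n] {ν : E3}

theorem IsLeaf.subset_level {L : Set (ConeProduct n K I)} (hL : IsLeaf ν L) :
    ∃ c, L ⊆ level ν c := by
  cases hL with
  | component x => exact ⟨_, connectedComponentIn_subset _ _⟩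
  | halfPlanes c hc x y =>
    exact ⟨c, Set.union_subset (Set.union_subset hc
      ((connectedComponentIn_subset _ _).trans Set.sdiff_subset))
      ((connectedComponentIn_subset _ _).trans Set.sdiff_subset)⟩

theorem exists_isWallNormal_inner_ne_zero {c : ℝ} (hc : ∀ z ∈ I, ν 2 * z ≠ c) :
    ∃ e, IsWallNormal e ∧ ∀ p ∈ slice K I ν c, inner ℝ e p ≠ 0 := by
  have hne : ∀ p ∈ slice K I ν c, ν 0 * p 0 + ν 1 * p 1 ≠ 0 := fun p hp h => by
    have hp' : inner ℝ ν p = c := hp.2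
    rw [inner_eq_sum, h, zero_add] at hp'
    exact hc _ hp.1.2 hp'
  rcases le_total 0 (ν 0) with h | h
  · refine ⟨!₂[ν 0, ν 1, 0], ⟨by simpa using h, by simp⟩, fun p hp => ?_⟩
    simpa [inner_eq_sum] using hne p hp
  · refine ⟨-!₂[ν 0, ν 1, 0], ⟨by simpa using h, by simp⟩, fun p hp => ?_⟩
    rw [inner_neg_left, neg_ne_zero]
    simpa [inner_eq_sum] using hne p hp

theorem exists_isContraction_component (hK : Convex ℝ K) (hI : I.OrdConnected)
    (hK0 : (0 : EuclideanSpace ℝ (Fin 2)) ∈ K) (x : ConeProduct n K I) :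
    ∃ o H, IsContraction (connectedComponentIn (level ν (inner ℝ ν (dev x))) x) o H := by
  by_cases h : ∃ z ∈ I, ν 2 * z = inner ℝ ν (dev x)
  · obtain ⟨z, hz, hzc⟩ := h
    have ho := isAxisCenter_of_mem hK hI hK0 hz
    exact ⟨_, _, isContraction_contract ho
      (contract_mem_component ho (by simpa [inner_eq_sum] using hzc))⟩
  · push Not at h
    obtain ⟨e, he, hne⟩ := exists_isWallNormal_inner_ne_zero (K := K) h
    exact ⟨dev x, exists_isContraction_of_ne_zero (convex_solid hK hI) he hne
      (dev_mem_slice rfl) x⟩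

theorem exists_isContraction_halfPlanes (hK : Convex ℝ K) (hI : I.OrdConnected)
    (hK0 : (0 : EuclideanSpace ℝ (Fin 2)) ∈ K) {c : ℝ}
    (hc : axis ⊆ (level ν c : Set (ConeProduct n K I))) (x y : ConeProduct n K I) :
    ∃ o H, IsContraction (axis ∪ connectedComponentIn (level ν c \ axis) x ∪
      connectedComponentIn (level ν c \ axis) y) o H := by
  have ho := isAxisCenter_of_mem hK hI hK0 (dev_mem_solid x).2
  have hmem {t : unitInterval} {w : ConeProduct n K I} :
      t = 1 ∨ w ∈ axis → contract ho t w ∈ axis := (contract_mem_axis_iff ho).2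
  have hoc : inner ℝ ν !₂[0, 0, dev x 2] = c := by
    have h : inner ℝ ν (dev (contract ho 1 x)) = c := hc (hmem (.inl rfl))
    rwa [dev_contract, Set.Icc.coe_one, AffineMap.lineMap_apply_one] at h
  refine ⟨_, _, isContraction_contract ho fun t w hw => ?_⟩
  rcases eq_or_ne t 1 with rfl | ht
  · exact .inl (.inl (hmem (.inl rfl)))
  · have hhalf {x₀ : ConeProduct n K I} := contract_mem_halfPlane ho hoc (x₀ := x₀)
      (lt_of_le_of_ne t.2.2 ht)
    exact hw.imp (Or.imp (fun h => hmem (.inr h)) (@hhalf x w)) (@hhalf y w)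

theorem IsLeaf.exists_isContraction (hK : Convex ℝ K) (hI : I.OrdConnected)
    (hK0 : (0 : EuclideanSpace ℝ (Fin 2)) ∈ K) {L : Set (ConeProduct n K I)} (hL : IsLeaf ν L) :
    ∃ o H, IsContraction L o H := by
  cases hL with
  | component x => exact exists_isContraction_component hK hI hK0 x
  | halfPlanes c hc x y => exact exists_isContraction_halfPlanes hK hI hK0 hc x y

end Leaves

end FlatCone

theorem theorem5_general (n : ℕ) [NeZero n] (K : Set (EuclideanSpace ℝ (Fin 2))) (hK : Convex ℝ K)
    (hK0 : 0 ∈ K) (I : Set ℝ) (hI : I.OrdConnected) (ν : FlatCone.E3) (hν : ν ≠ 0)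
    (L : Set (FlatCone.ConeProduct n K I)) (hL : FlatCone.IsLeaf ν L) :
    FlatCone.IsAreaMinimizing L := by
  rintro γ ⟨⟨C, hγ⟩, hclosed, -⟩ hγL
  obtain ⟨o, H, hH⟩ := hL.exists_isContraction hK hI hK0
  obtain ⟨c, hLc⟩ := hL.subset_level
  obtain ⟨S, hSL, hSγ⟩ := hH.exists_surface hγ hclosed hγL
  exact ⟨S, hSL, hSγ, fun S' hS' =>
    FlatCone.area_le_area (FlatCone.convex_solid hK hI) hν (hSL.trans hLc) hSγ hS'⟩

theorem theorem5 (n : ℕ) [NeZero n] (K : Set (EuclideanSpace ℝ (Fin 2))) (hK : Convex ℝ K)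
    (hK0 : 0 ∈ interior K) (I : Set ℝ) (hI : I.OrdConnected) (hI0 : (interior I).Nonempty)
    (ν : FlatCone.E3) (hν : ν ≠ 0) (L : Set (FlatCone.ConeProduct n K I))
    (hL : FlatCone.IsLeaf ν L) : FlatCone.IsAreaMinimizing L :=
  theorem5_general n K hK (interior_subset hK0) I hI ν hν L hL
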